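/- All manifolds, maps and forms are $C^\infty$. Let $(N,\Omega)$ be a symplectic manifold (Hausdorff, second countable), let $M\subseteq N$ be an embedded submanifold regularly defined by equations $\phi^{(0)}_1=\dots=\phi^{(0)}_{a_0}=0$, and let $M_c\subseteq M$ be an embedded submanifold (for instance the final constraint submanifold of a constraint algorithm starting from $M$) which is regularly defined in $N$ by equations $\phi^{(c)}_1=\dots=\phi^{(c)}_{a_c}=0$. Here $\{\phi_i=0\}$ is regularly defined if the $d\phi_i$ are linearly independent along it and its tangent spaces are $\bigcap_i\ker d\phi_i$. Let $\omega$ and $\omega_c$ be the pullbacks of $\Omega$ to $M$ and $M_c$, let $\{f,g\}=\Omega(X_f,X_g)$ with $\Omega(X_f,\cdot)=df$, and put $d^{(c)}(x)=a_0-\operatorname{rank}\big(\{\phi^{(c)}_i,\phi^{(0)}_j\}(x)\big)$ for $x\in M_c$. A leaf of a distribution $\Delta$ on $X$ is a maximal connected (injectively immersed) integral manifold of $\Delta$. The distribution $\Delta$ is said to determine a regular foliation $F$ if its leaves form a partition $F$ of $X$ and the leaf space $X/F$, with the quotient topology, has the structure of a smooth manifold (of some dimension, not necessarily Hausdorff)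 for which the natural map $p_F\colon X\to X/F$ is a submersion with $\ker Tp_F=\Delta$. Assume that $\ker\omega_c$ determines a regular foliation $K_c$ of $M_c$, with $\bar M_c=M_c/K_c$, that $\ker\omega$ determines a regular foliation $K$ of $M$, with $\bar M=M/K$, and that $\ker\omega(x)\cap T_xM_c$, $x\in M_c$, has constant rank. Then: (1) $\dim\big(\ker\omega(x)\cap T_xM_c\big)=d^{(c)}(x)$ for all $x\in M_c$. (2) For each leaf $S$ of $K$, the intersection $S\cap M_c$ is an embedded submanifold of $M_c$ (possibly empty or disconnected) which is an integral manifold of $\ker\omega\cap TM_c$. (3) $\ker\omega\cap TM_c$ determines a regular foliation $\widetilde K_c$ of $M_c$, with submersion $p_{\widetilde K_c}\colon M_c\to\widetilde M_c=M_c/\widetilde K_c$. Its leaf through $x\in M_c$ is the connected component containing $x$ of $S\cap M_c$, where $S$ is the leaf of $K$ through $x$. In particular, if $S\cap M_c$ is connected for every leaf $S$ of $K$, then the leaves of $\widetilde K_c$ are exactly the nonempty intersections $S\cap M_c$; in this case $\widetilde M_c$ is Hausdorff whenever $\bar M$ is. (4) Each leaf of $K_c$ is a union of leaves of $\widetilde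 K_c$, and the induced map $p_{K_c\widetilde K_c}\colon\widetilde M_c\to\bar M_c$, characterized by $p_{K_c\widetilde K_c}\circ p_{\widetilde K_c}=p_{K_c}$, is a submersion. -/

import Mathlib

open Set Module
open scoped Manifold ContDiff Topology

noncomputable section

/-! All manifolds are `C^∞`, finite-dimensional and without boundary: a manifold of dimension `n` is
modelled on `EuclideanSpace ℝ (Fin n)`, and `𝓡 n` is the corresponding model with corners. -/

section Forms

/-- A (not yet smooth) differential `2`-form on `X`: an alternating bilinear form on each tangent
space. -/
abbrev TwoForm (n : ℕ) (X : Type*) [TopologicalSpace X]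
    [ChartedSpace (EuclideanSpace ℝ (Fin n)) X] :=
  ∀ x : X, TangentSpace (𝓡 n) x [⋀^Fin 2]→L[ℝ] ℝ

/-- The coordinate expression of a `2`-form in the preferred chart around `x₀`, that is, its
pullback by the inverse of that chart. It is meaningful on the target of the chart. -/
def TwoForm.inChart {n : ℕ} {X : Type*} [TopologicalSpace X]
    [ChartedSpace (EuclideanSpace ℝ (Fin n)) X] (α : TwoForm n X) (x₀ : X)
    (y : EuclideanSpace ℝ (Fin n)) : EuclideanSpace ℝ (Fin n) [⋀^Fin 2]→L[ℝ] ℝ :=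
  (α ((extChartAt (𝓡 n) x₀).symm y)).compContinuousLinearMap
    (mfderiv 𝓘(ℝ, EuclideanSpace ℝ (Fin n)) (𝓡 n) (extChartAt (𝓡 n) x₀).symm y)

/-- The pullback `f^* α` of a `2`-form by a smooth map. -/
def TwoForm.pullback {m n : ℕ} {Y X : Type*} [TopologicalSpace Y]
    [ChartedSpace (EuclideanSpace ℝ (Fin m)) Y] [TopologicalSpace X]
    [ChartedSpace (EuclideanSpace ℝ (Fin n)) X] (f : Y → X) (α : TwoForm n X) : TwoForm m Y :=
  fun y => (α (f y)).compContinuousLinearMap (mfderiv (𝓡 m) (𝓡 n) f y)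

/-- A distribution in the wide sense: a linear subspace of each tangent space. -/
abbrev TangentDistribution (n : ℕ) (X : Type*) [TopologicalSpace X]
    [ChartedSpace (EuclideanSpace ℝ (Fin n)) X] :=
  ∀ x : X, Submodule ℝ (TangentSpace (𝓡 n) x)

/-- The linear map `T_x X → (T_x X)^*`, `v ↦ α(x)(v, ·)`. -/
def TwoForm.flat {n : ℕ} {X : Type*} [TopologicalSpace X]
    [ChartedSpace (EuclideanSpace ℝ (Fin n)) X] (α : TwoForm n X) (x : X) :
    TangentSpace (𝓡 n) x →ₗ[ℝ] Module.Dual ℝ (TangentSpace (𝓡 n) x) :=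
  LinearMap.mk₂ ℝ (fun v w => α x ![v, w])
    (fun v v' w => (α x).toMultilinearMap.cons_add ![w] v v')
    (fun c v w => (α x).toMultilinearMap.cons_smul ![w] c v)
    (fun v w w' => by
      have e : ∀ u, Function.update ![v, w] 1 u = ![v, u] := fun u => by
        ext i; fin_cases i <;> simp
      have h := (α x).toMultilinearMap.map_update_add ![v, w] 1 w w'
      rwa [e, e, e] at h)
    (fun c v w => by
      have e : ∀ u, Function.update ![v, w] 1 u = ![v, u] := fun u => by
        ext i; fin_cases i <;> simp
      have h := (α x).toMultilinearMap.map_update_smul ![v, w] 1 c w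
      rwa [e, e] at h)

/-- The kernel `ker α(x) = {v ∈ T_x X | α(x)(v, ·) = 0}` of a `2`-form. -/
def TwoForm.ker {n : ℕ} {X : Type*} [TopologicalSpace X]
    [ChartedSpace (EuclideanSpace ℝ (Fin n)) X] (α : TwoForm n X) : TangentDistribution n X :=
  fun x => LinearMap.ker (α.flat x)

end Forms

section Symplectic

/-- A symplectic form: a smooth, closed, nondegenerate `2`-form. Smoothness and closedness are
checked on coordinate expressions. -/
structure SymplecticForm (n : ℕ) (N : Type*) [TopologicalSpace N]
    [ChartedSpace (EuclideanSpace ℝ (Fin n)) N] where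
  form : TwoForm n N
  smooth : ∀ x₀ : N, ContDiffOn ℝ ∞ (form.inChart x₀) (extChartAt (𝓡 n) x₀).target
  closed : ∀ x₀ : N, ∀ y ∈ (extChartAt (𝓡 n) x₀).target, extDeriv (form.inChart x₀) y = 0
  nondegenerate : ∀ x : N, form.ker x = ⊥

variable {n : ℕ} {N : Type*} [TopologicalSpace N] [ChartedSpace (EuclideanSpace ℝ (Fin n)) N]

/-- The isomorphism `T_x N ≃ (T_x N)^*`, `v ↦ Ω(x)(v, ·)`, of a symplectic form. -/
def SymplecticForm.flatEquiv (Ω : SymplecticForm n N) (x : N) :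
    TangentSpace (𝓡 n) x ≃ₗ[ℝ] Module.Dual ℝ (TangentSpace (𝓡 n) x) :=
  haveI : FiniteDimensional ℝ (TangentSpace (𝓡 n) x) :=
    inferInstanceAs (FiniteDimensional ℝ (EuclideanSpace ℝ (Fin n)))
  LinearMap.linearEquivOfInjective (Ω.form.flat x) (LinearMap.ker_eq_bot.mp (Ω.nondegenerate x))
    Subspace.dual_finrank_eq.symm

/-- The Hamiltonian vector field `X_f`, defined by `Ω(X_f, ·) = df`. -/
def SymplecticForm.hamiltonianField (Ω : SymplecticForm n N) (f : N → ℝ) (x : N) :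
    TangentSpace (𝓡 n) x :=
  (Ω.flatEquiv x).symm (mvfderiv (𝓡 n) f x).toLinearMap

theorem SymplecticForm.form_hamiltonianField (Ω : SymplecticForm n N) (f : N → ℝ) (x : N)
    (w : TangentSpace (𝓡 n) x) :
    Ω.form x ![Ω.hamiltonianField f x, w] = mvfderiv (𝓡 n) f x w := by
  have h := (Ω.flatEquiv x).apply_symm_apply (mvfderiv (𝓡 n) f x).toLinearMap
  exact congrArg (fun L : Module.Dual ℝ (TangentSpace (𝓡 n) x) => L w) h

/-- The Poisson bracket `{f, g} = Ω(X_f, X_g)`. -/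
def SymplecticForm.poissonBracket (Ω : SymplecticForm n N) (f g : N → ℝ) (x : N) : ℝ :=
  Ω.form x ![Ω.hamiltonianField f x, Ω.hamiltonianField g x]

/-- The number `d^{(c)}(x) = a₀ - rank ({φ^{(c)}_i, φ^{(0)}_j}(x))`; as the matrix has `a₀` columns,
the subtraction is never truncated. -/
def SymplecticForm.dNumber (Ω : SymplecticForm n N) {a₀ a : ℕ} (φ₀ : Fin a₀ → N → ℝ)
    (φ : Fin a → N → ℝ) (x : N) : ℕ :=
  a₀ - (Matrix.of fun (i : Fin a) (j : Fin a₀) => Ω.poissonBracket (φ i) (φ₀ j) x).rank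

end Symplectic

section Submanifolds

variable {n : ℕ} {X : Type*} [TopologicalSpace X] [ChartedSpace (EuclideanSpace ℝ (Fin n)) X]

/-- The submanifold of `X` given by the embedding `j : Y → X` is regularly defined by the equations
`φ_i = 0`: it is the zero locus of the smooth functions `φ_i`, whose differentials are linearly
independent along it, and its tangent spaces are the common kernels of these differentials. -/
structure RegularlyDefinedBy {m : ℕ} {Y : Type*} [TopologicalSpace Y]
    [ChartedSpace (EuclideanSpace ℝ (Fin m)) Y] (j : Y → X) {a : ℕ} (φ : Fin a → X → ℝ) :
    Prop where
  embedding : Manifold.IsSmoothEmbedding (𝓡 m) (𝓡 n) ∞ j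
  smooth : ∀ i, ContMDiff (𝓡 n) 𝓘(ℝ, ℝ) ∞ (φ i)
  range_eq : range j = {x | ∀ i, φ i x = 0}
  independent : ∀ x ∈ range j, LinearIndependent ℝ fun i => mvfderiv (𝓡 n) (φ i) x
  tangent : ∀ y : Y, LinearMap.range (mfderiv (𝓡 m) (𝓡 n) j y).toLinearMap =
    ⨅ i, LinearMap.ker (mvfderiv (𝓡 n) (φ i) (j y)).toLinearMap

/-- The injective immersion `j : S → X` is an integral manifold of the distribution `Δ`: its tangent
spaces are the spaces of `Δ`. -/
structure IsIntegralManifold (Δ : TangentDistribution n X) {r : ℕ} {S : Type*} [TopologicalSpace S]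
    [ChartedSpace (EuclideanSpace ℝ (Fin r)) S] (j : S → X) : Prop where
  isManifold : IsManifold (𝓡 r) ∞ S
  isImmersion : Manifold.IsImmersion (𝓡 r) (𝓡 n) ∞ j
  injective : Function.Injective j
  tangent : ∀ s : S, LinearMap.range (mfderiv (𝓡 r) (𝓡 n) j s).toLinearMap = Δ (j s)

end Submanifolds

section Foliations

universe u

variable {n : ℕ} {X : Type u} [TopologicalSpace X] [ChartedSpace (EuclideanSpace ℝ (Fin n)) X]

/-- The set `L` is (the image of) a connected integral manifold of `Δ`. -/
def IsConnectedIntegralSet (Δ : TangentDistribution n X) (L : Set X) : Prop :=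
  ∃ (r : ℕ) (S : Type u) (_ : TopologicalSpace S) (_ : ChartedSpace (EuclideanSpace ℝ (Fin r)) S)
    (j : S → X), ConnectedSpace S ∧ IsIntegralManifold (r := r) Δ j ∧ range j = L

/-- The set `L` is (the image of) an integral manifold of `Δ`, possibly empty or disconnected, which
is an embedded submanifold. -/
def IsEmbeddedIntegralSet (Δ : TangentDistribution n X) (L : Set X) : Prop :=
  ∃ (r : ℕ) (S : Type u) (_ : TopologicalSpace S) (_ : ChartedSpace (EuclideanSpace ℝ (Fin r)) S)
    (j : S → X), Topology.IsEmbedding j ∧ IsIntegralManifold (r := r) Δ j ∧ range j = L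

/-- A leaf of `Δ`: a maximal connected integral manifold. -/
def IsLeaf (Δ : TangentDistribution n X) (L : Set X) : Prop :=
  IsConnectedIntegralSet Δ L ∧
    ∀ L' : Set X, IsConnectedIntegralSet Δ L' → (L' ∩ L).Nonempty → L' ⊆ L

/-- A regular foliation determined by the distribution `Δ`: a partition of `X` (the classes of the
equivalence relation `rel`) into leaves of `Δ`, together with a structure of smooth manifold on the
leaf space, with the quotient topology, for which the natural projection is a submersion with
kernel `Δ`. The leaf space of a regular foliation is not required to be Hausdorff. -/
structure RegularFoliation (Δ : TangentDistribution n X) where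
  rel : Setoid X
  isLeaf : ∀ x, IsLeaf Δ {y | rel y x}
  codim : ℕ
  charts : ChartedSpace (EuclideanSpace ℝ (Fin codim)) (Quotient rel)
  isManifold : IsManifold (𝓡 codim) ∞ (Quotient rel)
  submersion : Manifold.IsSubmersion (𝓡 n) (𝓡 codim) ∞ (Quotient.mk rel)
  ker_mfderiv : ∀ x,
    LinearMap.ker (mfderiv (𝓡 n) (𝓡 codim) (Quotient.mk rel) x).toLinearMap = Δ x

namespace RegularFoliation

variable {Δ : TangentDistribution n X} (K : RegularFoliation Δ)

/-- The leaf of the foliation through `x`. -/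
def leaf (x : X) : Set X := {y | K.rel y x}

/-- The leaf space `X / K`. -/
abbrev LeafSpace : Type u := Quotient K.rel

instance : ChartedSpace (EuclideanSpace ℝ (Fin K.codim)) K.LeafSpace := K.charts

/-- The natural projection `p_K : X → X / K`. -/
def proj : X → K.LeafSpace := Quotient.mk K.rel

end RegularFoliation

/-- The distribution `y ↦ Δ(j(y)) ∩ T_y Y` on a submanifold `j : Y → X`, where a tangent vector of
`Y` is regarded as a tangent vector of `X` through the differential of `j`. -/
def TangentDistribution.inter {m : ℕ} {Y : Type*} [TopologicalSpace Y]
    [ChartedSpace (EuclideanSpace ℝ (Fin m)) Y] (Δ : TangentDistribution n X) (j : Y → X) :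
    TangentDistribution m Y :=
  fun y => (Δ (j y)).comap (mfderiv (𝓡 m) (𝓡 n) j y).toLinearMap

end Foliations

end

/-!
The theorem is about the fibres of one map. Let `g : M_c → M / K` be the restriction to `M_c` of the
projection of the foliation `K`. The kernel of its differential is `Δ = ker ω ∩ T M_c`, which has
constant rank by assumption, and its fibres are the intersections of `M_c` with the leaves of `K`.

By the constant rank theorem (`exists_flat_coordinates`, `nonempty_flatChart`), every point of `M_c`
has coordinates in a product of two balls in which `g` is an injective function of the first
component; the slices with fixed first component are called plaques. So distinct plaques of one
coordinate domain lie in distinct fibres, and, plaques being connected, a fibre or a connected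
component of a fibre meets the coordinate domain around any of its points in exactly one plaque. The
second component is then a chart of the fibre, which is an embedded integral manifold of `Δ`
(`FlatChart.isIntegralManifold_subtypeVal`); the first component is a chart of the space of
components of fibres (`FlatChart.leafChart`), because every plaque is determined by the value of `g`.
A connected integral manifold of `Δ` lies in a single fibre, since the differential of `g` vanishes
along it (`eq_of_mfderiv_eq_zero`); hence the components of the fibres are the leaves of `Δ`
(`isLeaf_fiberComponent`) and form a regular foliation (`exists_regularFoliation_fiberComponent`).
None of this requires `M / K` to be Hausdorff.

Since `Δ` is contained in `ker ω_c`, the projection to `M_c / K_c` is constant on the leaves of `Δ`.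
The induced map is smooth because the projection of a foliation has smooth local sections, and its
differentials are surjective because those of the projection to `M_c / K_c` are; it is a submersion
by the constant rank theorem again (`isSubmersion_of_surjective_mfderiv`). If the fibres of `g` are
connected, then `g` induces a continuous injection of the leaf space into `M / K`, which transports
the Hausdorff property.

The dimension formula is linear algebra (`finrank_eq_sub_rank`): the symplectic orthogonal of `T M`
is spanned by the Hamiltonian vectors of the equations of `M`, and a combination of these is tangent
to `M_c` if and only if the matrix of Poisson brackets annihilates its coefficients.
-/

noncomputable section

/-! ### The constant rank theorem in normed spaces -/

section LinearAlgebra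

variable {E F : Type*} [NormedAddCommGroup E] [NormedSpace ℝ E] [FiniteDimensional ℝ E]
  [NormedAddCommGroup F] [NormedSpace ℝ F] [FiniteDimensional ℝ F]

/-- A linear map with `r`-dimensional kernel is completed to a linear isomorphism: `π` is injective
on the range of `D`, and `κ` is injective on the kernel of `D`. -/
theorem ContinuousLinearMap.exists_equiv_prod_of_finrank_ker (D : E →L[ℝ] F) {s r : ℕ}
    (hs : finrank ℝ E = s + r) (hr : finrank ℝ (LinearMap.ker D.toLinearMap) = r) :
    ∃ (π : F →L[ℝ] EuclideanSpace ℝ (Fin s)) (κ : E →L[ℝ] EuclideanSpace ℝ (Fin r))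
      (A : E ≃L[ℝ] EuclideanSpace ℝ (Fin s) × EuclideanSpace ℝ (Fin r)),
      Function.Surjective π ∧ (A : E →L[ℝ] _) = (π.comp D).prod κ := by
  have hrange : finrank ℝ (LinearMap.range D.toLinearMap) = s := by
    have := LinearMap.finrank_range_add_finrank_ker D.toLinearMap
    omega
  let e₁ : LinearMap.range D.toLinearMap ≃ₗ[ℝ] EuclideanSpace ℝ (Fin s) :=
    LinearEquiv.ofFinrankEq _ _ (by simp [hrange])
  let e₂ : LinearMap.ker D.toLinearMap ≃ₗ[ℝ] EuclideanSpace ℝ (Fin r) :=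
    LinearEquiv.ofFinrankEq _ _ (by simp [hr])
  obtain ⟨P, hP⟩ := LinearMap.exists_leftInverse_of_injective
    (LinearMap.range D.toLinearMap).subtype (Submodule.ker_subtype _)
  obtain ⟨Q, hQ⟩ := LinearMap.exists_leftInverse_of_injective
    (LinearMap.ker D.toLinearMap).subtype (Submodule.ker_subtype _)
  have hP' (w : LinearMap.range D.toLinearMap) : P w = w := LinearMap.congr_fun hP w
  have hQ' (w : LinearMap.ker D.toLinearMap) : Q w = w := LinearMap.congr_fun hQ w
  let π : F →L[ℝ] EuclideanSpace ℝ (Fin s) := (e₁.toLinearMap ∘ₗ P).toContinuousLinearMap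
  let κ : E →L[ℝ] EuclideanSpace ℝ (Fin r) := (e₂.toLinearMap ∘ₗ Q).toContinuousLinearMap
  have hinj : Function.Injective ((π.comp D).prod κ).toLinearMap := by
    rw [← LinearMap.ker_eq_bot, LinearMap.ker_eq_bot']
    intro v hv
    have h1 : e₁ (P (D v)) = 0 := congrArg Prod.fst hv
    have h2 : e₂ (Q v) = 0 := congrArg Prod.snd hv
    have h3 : P (D v) = ⟨D v, v, rfl⟩ := hP' ⟨D v, v, rfl⟩
    rw [h3, LinearEquiv.map_eq_zero_iff, Subtype.ext_iff] at h1
    have h4 : Q v = ⟨v, h1⟩ := hQ' ⟨v, h1⟩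
    rw [h4, LinearEquiv.map_eq_zero_iff, Subtype.ext_iff] at h2
    exact h2
  refine ⟨π, κ, (LinearEquiv.ofInjectiveOfFinrankEq _ hinj (by simp [hs])).toContinuousLinearEquiv,
    ?_, ?_⟩
  · intro u
    refine ⟨(e₁.symm u : F), ?_⟩
    change e₁ (P (e₁.symm u : F)) = u
    rw [hP', LinearEquiv.apply_symm_apply]
  · ext v <;> rfl

end LinearAlgebra

/-- **Constant rank theorem.** Near a point, a map of constant rank `s` is an injective function of
the first component of a coordinate system with values in `ℝ^s × ℝ^r`; that component is itself a
linear function of the map. -/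
theorem exists_flat_coordinates {E F : Type*} [NormedAddCommGroup E] [NormedSpace ℝ E]
    [FiniteDimensional ℝ E] [NormedAddCommGroup F] [NormedSpace ℝ F] [FiniteDimensional ℝ F]
    {G : E → F} {O : Set E} (hO : IsOpen O) (hG : ContDiffOn ℝ ∞ G O) {s r : ℕ}
    (hs : finrank ℝ E = s + r)
    (hr : ∀ y ∈ O, finrank ℝ (LinearMap.ker (fderiv ℝ G y).toLinearMap) = r)
    {y₀ : E} (hy₀ : y₀ ∈ O) :
    ∃ (e : OpenPartialHomeomorph E (EuclideanSpace ℝ (Fin s) × EuclideanSpace ℝ (Fin r)))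
      (π : F →L[ℝ] EuclideanSpace ℝ (Fin s)) (ε : ℝ), 0 < ε ∧ y₀ ∈ e.source ∧ e.source ⊆ O ∧
      e y₀ = 0 ∧ e.target = Metric.ball 0 ε ×ˢ Metric.ball 0 ε ∧ ContDiffOn ℝ ∞ e e.source ∧
      ContDiffOn ℝ ∞ e.symm e.target ∧ Function.Surjective π ∧
      (∀ y ∈ e.source, (e y).1 = π (G y) - π (G y₀)) ∧
      ∀ y ∈ e.source, ∀ y' ∈ e.source, (e y).1 = (e y').1 → G y = G y' := by
  obtain ⟨π, κ, A, hπ, hA⟩ :=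
    (fderiv ℝ G y₀).exists_equiv_prod_of_finrank_ker hs (hr y₀ hy₀)
  let Ψ : E → EuclideanSpace ℝ (Fin s) × EuclideanSpace ℝ (Fin r) :=
    fun y => (π (G y) - π (G y₀), κ (y - y₀))
  have hGat (y) (hy : y ∈ O) : ContDiffAt ℝ ∞ G y := hG.contDiffAt (hO.mem_nhds hy)
  have hGd (y) (hy : y ∈ O) : HasFDerivAt G (fderiv ℝ G y) y :=
    ((hGat y hy).differentiableAt (by simp)).hasFDerivAt
  have hΨat (y) (hy : y ∈ O) : ContDiffAt ℝ ∞ Ψ y := by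
    have := hGat y hy
    fun_prop
  have hΨd (y) (hy : y ∈ O) : HasFDerivAt Ψ ((π.comp (fderiv ℝ G y)).prod κ) y :=
    ((π.hasFDerivAt.comp y (hGd y hy)).sub_const _).prodMk
      (κ.hasFDerivAt.comp y ((hasFDerivAt_id y).sub_const y₀))
  have hΨ₀ : HasFDerivAt Ψ (A : E →L[ℝ] _) y₀ := by rw [hA]; exact hΨd y₀ hy₀
  -- restricting to points where `dΨ` is invertible makes the inverse of `Ψ` smooth near all values
  let O₁ : Set E := O ∩ (fun y => (π.comp (fderiv ℝ G y)).prod κ) ⁻¹'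
    range ((↑) : (E ≃L[ℝ] EuclideanSpace ℝ (Fin s) × EuclideanSpace ℝ (Fin r)) → E →L[ℝ] _)
  have hO₁ : IsOpen O₁ := by
    have hc : ContinuousOn (fderiv ℝ G) O := hG.continuousOn_fderiv_of_isOpen hO (by simp)
    have hp : Continuous fun D : E →L[ℝ] F => (π.comp D).prod κ := by
      have : (fun D : E →L[ℝ] F => (π.comp D).prod κ) =
          fun D => (ContinuousLinearMap.inl ℝ _ _).comp (π.comp D) +
            (ContinuousLinearMap.inr ℝ _ _).comp κ := by
        ext D v <;> simp
      rw [this]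
      fun_prop
    exact (hp.comp_continuousOn hc).isOpen_inter_preimage hO (ContinuousLinearEquiv.isOpen)
  have hy₁ : y₀ ∈ O₁ := ⟨hy₀, A, hA⟩
  let e₀ := (hΨat y₀ hy₀).toOpenPartialHomeomorph Ψ hΨ₀ (by simp)
  have he₀ : ⇑e₀ = Ψ := ContDiffAt.toOpenPartialHomeomorph_coe ..
  have hm₀ : y₀ ∈ e₀.source := ContDiffAt.mem_toOpenPartialHomeomorph_source ..
  let e₁ := e₀.restrOpen O₁ hO₁
  have hm₁ : y₀ ∈ e₁.source := ⟨hm₀, hy₁⟩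
  have he₁ : ⇑e₁ = Ψ := he₀
  have hΨ0 : Ψ y₀ = 0 := by simp [Ψ]
  obtain ⟨ε, hε, hball⟩ := Metric.isOpen_iff.mp e₁.open_target 0 (by
    have := e₁.map_source hm₁
    rwa [he₁, hΨ0] at this)
  let e := (e₁.symm.restrOpen (Metric.ball 0 ε) Metric.isOpen_ball).symm
  have he : ⇑e = Ψ := he₁
  have htarget : e.target = Metric.ball 0 ε ×ˢ Metric.ball 0 ε := by
    rw [ball_prod_same]
    change e₁.target ∩ Metric.ball 0 ε = _
    exact inter_eq_right.mpr hball
  have hsub : e.source ⊆ e₁.source := fun y hy => (e.symm_symm ▸ e.left_inv hy) ▸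
    e₁.map_target (hball (by
      have := e.map_source hy
      rwa [htarget, ball_prod_same] at this))
  have hsO₁ : e.source ⊆ O₁ := fun y hy => (hsub hy).2
  have hsO : e.source ⊆ O := fun y hy => (hsO₁ hy).1
  have hy₀e : y₀ ∈ e.source := by
    have h0 : (0 : EuclideanSpace ℝ (Fin s) × EuclideanSpace ℝ (Fin r)) ∈ e.target := by
      rw [htarget]; exact ⟨Metric.mem_ball_self hε, Metric.mem_ball_self hε⟩
    have h1 : e.symm 0 = y₀ := by
      have := e₁.left_inv hm₁
      rwa [he₁, hΨ0] at this
    exact h1 ▸ e.map_target h0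
  have hsymm : ContDiffOn ℝ ∞ e.symm e.target := by
    intro q hq
    obtain ⟨hO', B, hB⟩ := hsO₁ (e.map_target hq)
    refine (e.contDiffAt_symm (f₀' := B) hq ?_ ?_).contDiffWithinAt
    · rw [hB, he]; exact hΨd _ hO'
    · rw [he]; exact hΨat _ hO'
  refine ⟨e, π, ε, hε, hy₀e, hsO, by rw [he, hΨ0], htarget, ?_, hsymm, hπ, ?_, ?_⟩
  · rw [he]; exact fun y hy => (hΨat y (hsO hy)).contDiffWithinAt
  · intro y _; rw [he]
  · -- the map is constant along slices with fixed first component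
    have key (u : EuclideanSpace ℝ (Fin s)) (hu : u ∈ Metric.ball 0 ε) :
        ∀ v ∈ Metric.ball (0 : EuclideanSpace ℝ (Fin r)) ε,
        ∀ v' ∈ Metric.ball (0 : EuclideanSpace ℝ (Fin r)) ε,
          G (e.symm (u, v)) = G (e.symm (u, v')) := by
      have hmem (v) (hv : v ∈ Metric.ball (0 : EuclideanSpace ℝ (Fin r)) ε) :
          (u, v) ∈ e.target := by
        rw [htarget]; exact ⟨hu, hv⟩
      have hd (v) (hv : v ∈ Metric.ball (0 : EuclideanSpace ℝ (Fin r)) ε) :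
          HasFDerivAt (fun v => G (e.symm (u, v)))
            (0 : EuclideanSpace ℝ (Fin r) →L[ℝ] F) v := by
        have hy := hsO₁ (e.map_target (hmem v hv))
        set y := e.symm (u, v) with hydef
        obtain ⟨hyO, B, hB⟩ := hy
        have hσ : HasFDerivAt (fun v => e.symm (u, v))
            ((fderiv ℝ e.symm (u, v)).comp (ContinuousLinearMap.inr ℝ _ _)) v :=
          HasFDerivAt.comp v (((hsymm.contDiffAt (e.open_target.mem_nhds (hmem v hv))
            ).differentiableAt (by simp)).hasFDerivAt) (hasFDerivAt_prodMk_right u v)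
        set S := (fderiv ℝ e.symm (u, v)).comp (ContinuousLinearMap.inr ℝ _ _)
        -- the kernels of `dG` and `π ∘ dG` have the same dimension
        have hker : LinearMap.ker (fderiv ℝ G y).toLinearMap =
            LinearMap.ker (π.comp (fderiv ℝ G y)).toLinearMap := by
          refine Submodule.eq_of_le_of_finrank_eq (fun w hw => ?_) ?_
          · have hw : fderiv ℝ G y w = 0 := hw
            simp [hw]
          · have hsurj : LinearMap.range (π.comp (fderiv ℝ G y)).toLinearMap = ⊤ := by
              rw [LinearMap.range_eq_top]
              intro a
              refine ⟨B.symm (a, 0), ?_⟩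
              have := congrArg Prod.fst (DFunLike.congr_fun hB (B.symm (a, 0)))
              simpa using this.symm
            have h1 := LinearMap.finrank_range_add_finrank_ker (π.comp (fderiv ℝ G y)).toLinearMap
            rw [hsurj, finrank_top, finrank_euclideanSpace_fin] at h1
            rw [hr y hyO]
            omega
        have hc : HasFDerivAt (fun v => G (e.symm (u, v))) ((fderiv ℝ G y).comp S) v :=
          (hGd y hyO).comp v hσ
        have hπc : HasFDerivAt (fun v => π (G (e.symm (u, v)))) (π.comp ((fderiv ℝ G y).comp S)) v :=
          π.hasFDerivAt.comp v hc
        have hπ0 : HasFDerivAt (fun v => π (G (e.symm (u, v))))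
            (0 : EuclideanSpace ℝ (Fin r) →L[ℝ] EuclideanSpace ℝ (Fin s)) v := by
          refine (hasFDerivAt_const (u + π (G y₀)) v).congr_of_eventuallyEq ?_
          filter_upwards [Metric.isOpen_ball.mem_nhds hv] with w hw
          have := congrArg Prod.fst (e.right_inv (hmem w hw))
          rw [he] at this
          exact sub_eq_iff_eq_add.mp this
        have h0 := hπc.unique hπ0
        have hz : (fderiv ℝ G y).comp S = 0 := by
          ext1 w
          have : S w ∈ LinearMap.ker (fderiv ℝ G y).toLinearMap := by
            rw [hker]; exact DFunLike.congr_fun h0 w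
          exact this
        rwa [hz] at hc
      intro v hv v' hv'
      exact Metric.isOpen_ball.is_const_of_fderiv_eq_zero (𝕜 := ℝ)
        (convex_ball _ _).isPreconnected
        (fun w hw => (hd w hw).differentiableAt.differentiableWithinAt)
        (fun w hw => (hd w hw).fderiv) hv hv'
    intro y hy y' hy' hyy'
    have h1 := e.map_source hy
    have h2 := e.map_source hy'
    rw [htarget] at h1 h2
    have := key (e y).1 h1.1 (e y).2 h1.2 (e y').2 h2.2
    rw [Prod.mk.eta, e.left_inv hy, hyy', Prod.mk.eta, e.left_inv hy'] at this
    exact this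

/-! ### The constant rank theorem for manifolds -/

theorem finrank_ker_comp_comp {V V' W W' : Type*} [AddCommGroup V] [Module ℝ V] [AddCommGroup V']
    [Module ℝ V'] [AddCommGroup W] [Module ℝ W] [AddCommGroup W'] [Module ℝ W']
    (A : W →ₗ[ℝ] W') (D : V →ₗ[ℝ] W) (B : V' ≃ₗ[ℝ] V) (hA : LinearMap.ker A = ⊥) :
    finrank ℝ (LinearMap.ker (A ∘ₗ D ∘ₗ B.toLinearMap)) = finrank ℝ (LinearMap.ker D) := by
  have h : LinearMap.ker (A ∘ₗ D ∘ₗ B.toLinearMap) = (LinearMap.ker D).comap B.toLinearMap := by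
    rw [LinearMap.ker_comp_of_ker_eq_bot _ hA, LinearMap.ker_comp]
  rw [h, Submodule.comap_equiv_eq_map_symm]
  exact (B.symm.submoduleMap (LinearMap.ker D)).finrank_eq.symm

section

variable {n b : ℕ} {X B : Type*} [TopologicalSpace X] [ChartedSpace (EuclideanSpace ℝ (Fin n)) X]
  [TopologicalSpace B] [ChartedSpace (EuclideanSpace ℝ (Fin b)) B]

variable (n b) in
/-- Coordinates around `x` in which the map `g : X → B` of constant rank `s` is an injective
function of the first component. They are centred at `x`, have values in a product of balls, and
their first component is an affine function of `g` in the preferred chart of `B` at `g x`. -/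
structure FlatChart (g : X → B) (s r : ℕ) (x : X) where
  /-- The coordinates. -/
  e : OpenPartialHomeomorph X (EuclideanSpace ℝ (Fin s) × EuclideanSpace ℝ (Fin r))
  /-- The linear map that gives the first component in terms of `g`. -/
  π : EuclideanSpace ℝ (Fin b) →L[ℝ] EuclideanSpace ℝ (Fin s)
  /-- The radius of the target. -/
  ε : ℝ
  ε_pos : 0 < ε
  mem : x ∈ e.source
  apply_self : e x = 0
  target_eq : e.target = Metric.ball 0 ε ×ˢ Metric.ball 0 ε
  contMDiffOn : ContMDiffOn (𝓡 n)
    𝓘(ℝ, EuclideanSpace ℝ (Fin s) × EuclideanSpace ℝ (Fin r)) ∞ e e.source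
  contMDiffOn_symm : ContMDiffOn
    𝓘(ℝ, EuclideanSpace ℝ (Fin s) × EuclideanSpace ℝ (Fin r)) (𝓡 n) ∞ e.symm e.target
  surjective_π : Function.Surjective π
  mapsTo : MapsTo g e.source (chartAt (EuclideanSpace ℝ (Fin b)) (g x)).source
  fst_apply : ∀ y ∈ e.source, (e y).1 =
    π (chartAt (EuclideanSpace ℝ (Fin b)) (g x) (g y)) -
      π (chartAt (EuclideanSpace ℝ (Fin b)) (g x) (g x))
  eq_of_fst_eq : ∀ y ∈ e.source, ∀ y' ∈ e.source, (e y).1 = (e y').1 → g y = g y'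

/-- The constant rank theorem for manifolds. -/
theorem nonempty_flatChart [IsManifold (𝓡 n) ∞ X] [IsManifold (𝓡 b) ∞ B] {g : X → B}
    (hg : ContMDiff (𝓡 n) (𝓡 b) ∞ g) {s r : ℕ} (hn : n = s + r)
    (hr : ∀ x, finrank ℝ (LinearMap.ker (mfderiv (𝓡 n) (𝓡 b) g x).toLinearMap) = r) (x : X) :
    Nonempty (FlatChart n b g s r x) := by
  let φ := chartAt (EuclideanSpace ℝ (Fin n)) x
  let ψ := chartAt (EuclideanSpace ℝ (Fin b)) (g x)
  let G : EuclideanSpace ℝ (Fin n) → EuclideanSpace ℝ (Fin b) := ψ ∘ g ∘ φ.symm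
  let O : Set (EuclideanSpace ℝ (Fin n)) := φ.target ∩ φ.symm ⁻¹' (g ⁻¹' ψ.source)
  have hO : IsOpen O := φ.isOpen_inter_preimage_symm (ψ.open_source.preimage hg.continuous)
  have hGm : ContMDiffOn (𝓡 n) (𝓡 b) ∞ G O := by
    refine (contMDiffOn_chart (I := 𝓡 b) (x := g x)).comp
      (hg.comp_contMDiffOn ((contMDiffOn_chart_symm (I := 𝓡 n) (x := x)).mono ?_)) ?_
    · exact fun y hy => hy.1
    · exact fun y hy => hy.2
  have hG : ContDiffOn ℝ ∞ G O := contMDiffOn_iff_contDiffOn.mp hGm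
  have hmd (p : X) : MDifferentiableAt (𝓡 n) (𝓡 b) g p := hg.mdifferentiableAt (by simp)
  have hφ : φ.MDifferentiable (𝓡 n) (𝓡 n) := mdifferentiable_chart x
  have hψ : ψ.MDifferentiable (𝓡 b) (𝓡 b) := mdifferentiable_chart (g x)
  have hGr : ∀ y ∈ O, finrank ℝ (LinearMap.ker (fderiv ℝ G y).toLinearMap) = r := by
    intro y hy
    have h1 : fderiv ℝ G y = mfderiv (𝓡 n) (𝓡 b) G y := (mfderiv_eq_fderiv).symm
    have h2 : MDifferentiableAt (𝓡 n) (𝓡 n) φ.symm y := hφ.mdifferentiableAt_symm hy.1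
    have h3 : MDifferentiableAt (𝓡 b) (𝓡 b) ψ (g (φ.symm y)) := hψ.mdifferentiableAt hy.2
    have h4 : mfderiv (𝓡 n) (𝓡 b) G y = (mfderiv (𝓡 b) (𝓡 b) ψ (g (φ.symm y))).comp
        ((mfderiv (𝓡 n) (𝓡 b) g (φ.symm y)).comp (mfderiv (𝓡 n) (𝓡 n) φ.symm y)) := by
      rw [← mfderiv_comp y (hmd _) h2]
      exact mfderiv_comp y h3 ((hmd _).comp y h2)
    have h5 := finrank_ker_comp_comp
      (mfderiv (𝓡 b) (𝓡 b) ψ (g (φ.symm y))).toLinearMap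
      (mfderiv (𝓡 n) (𝓡 b) g (φ.symm y)).toLinearMap
      (hφ.symm.mfderiv hy.1).toLinearEquiv (hψ.ker_mfderiv_eq_bot hy.2)
    rw [hr] at h5
    rw [h1, h4]
    exact h5
  have hxO : φ x ∈ O := by
    have hx : φ.symm (φ x) = x := φ.left_inv (mem_chart_source _ x)
    refine ⟨mem_chart_target _ x, ?_⟩
    change g (φ.symm (φ x)) ∈ ψ.source
    rw [hx]
    exact mem_chart_source _ _
  obtain ⟨e, π, ε, hε, hxe, hsub, he0, htarget, hesm, hesymm, hπ, hfst, hinj⟩ :=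
    exists_flat_coordinates hO hG (by simpa using hn) hGr hxO
  have hsource (y) (hy : y ∈ (φ.trans e).source) : φ y ∈ e.source ∧ φ.symm (φ y) = y := by
    rw [OpenPartialHomeomorph.trans_source] at hy
    exact ⟨hy.2, φ.left_inv hy.1⟩
  have htar : (φ.trans e).target = e.target := by
    rw [OpenPartialHomeomorph.trans_target]
    exact inter_eq_left.mpr fun q hq => (hsub (e.map_target hq)).1
  have hGφ (y) (hy : y ∈ (φ.trans e).source) : G (φ y) = ψ (g y) := by
    change ψ (g (φ.symm (φ y))) = _
    rw [(hsource y hy).2]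
  have hmap : MapsTo g (φ.trans e).source ψ.source := by
    intro y hy
    have : g (φ.symm (φ y)) ∈ ψ.source := (hsub (hsource y hy).1).2
    rwa [(hsource y hy).2] at this
  have hx' : x ∈ (φ.trans e).source := by
    rw [OpenPartialHomeomorph.trans_source]
    exact ⟨mem_chart_source _ x, hxe⟩
  refine ⟨⟨φ.trans e, π, ε, hε, hx', he0, htar.trans htarget, ?_, ?_, hπ, hmap, ?_, ?_⟩⟩
  · refine (contMDiffOn_iff_contDiffOn.mpr hesm).comp
      ((contMDiffOn_chart (I := 𝓡 n) (x := x)).mono fun y hy => ?_) fun y hy => (hsource y hy).1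
    rw [OpenPartialHomeomorph.trans_source] at hy
    exact hy.1
  · rw [htar]
    exact (contMDiffOn_chart_symm (I := 𝓡 n) (x := x)).comp
      (contMDiffOn_iff_contDiffOn.mpr hesymm) fun q hq => (hsub (e.map_target hq)).1
  · intro y hy
    change (e (φ y)).1 = _
    rw [hfst _ (hsource y hy).1, hGφ y hy, hGφ x hx']
  · intro y hy y' hy' h
    have := hinj _ (hsource y hy).1 _ (hsource y' hy').1 h
    rw [hGφ y hy, hGφ y' hy'] at this
    exact ψ.injOn (hmap hy) (hmap hy') this

end

/-! ### Differentials of immersions and submersions -/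

section

variable {n b : ℕ} {X B : Type*} [TopologicalSpace X] [ChartedSpace (EuclideanSpace ℝ (Fin n)) X]
  [TopologicalSpace B] [ChartedSpace (EuclideanSpace ℝ (Fin b)) B]

theorem Manifold.IsImmersion.ker_mfderiv_eq_bot {f : X → B}
    (hf : IsImmersion (𝓡 n) (𝓡 b) ∞ f) (x : X) :
    LinearMap.ker (mfderiv (𝓡 n) (𝓡 b) f x).toLinearMap = ⊥ := by
  have h := hf.isImmersionAt x
  -- a local left inverse of `f`
  let L : B → X := h.domChart.symm ∘ (fun z => (h.equiv.symm z).1) ∘ h.codChart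
  have hL (y) (hy : y ∈ h.domChart.source) : L (f y) = y := by
    have := h.writtenInCharts (show h.domChart y ∈ (h.domChart.extend (𝓡 n)).target by
      simpa using h.domChart.map_source hy)
    simp only [OpenPartialHomeomorph.extend_coe, OpenPartialHomeomorph.extend_coe_symm,
      modelWithCornersSelf_coe, modelWithCornersSelf_coe_symm, Function.comp_apply, id_eq,
      h.domChart.left_inv hy] at this
    simp [L, this, h.domChart.left_inv hy]
  have hxs := h.mem_domChart_source
  have hfx := h.mem_codChart_source
  have hd : (h.equiv.symm (h.codChart (f x))).1 = h.domChart x := by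
    have := h.writtenInCharts (show h.domChart x ∈ (h.domChart.extend (𝓡 n)).target by
      simpa using h.domChart.map_source hxs)
    simp only [OpenPartialHomeomorph.extend_coe, OpenPartialHomeomorph.extend_coe_symm,
      modelWithCornersSelf_coe, modelWithCornersSelf_coe_symm, Function.comp_apply, id_eq,
      h.domChart.left_inv hxs] at this
    simp [this]
  have hLm : ContMDiffAt (𝓡 b) (𝓡 n) ∞ L (f x) := by
    have h1 : ContMDiffAt (𝓡 b) (𝓡 b) ∞ h.codChart (f x) :=
      contMDiffAt_of_mem_maximalAtlas h.codChart_mem_maximalAtlas hfx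
    have h2 : ContMDiffAt (𝓡 b) (𝓡 n) ∞ (fun z => (h.equiv.symm z).1) (h.codChart (f x)) :=
      ContDiffAt.contMDiffAt (by fun_prop)
    have h3 : ContMDiffAt (𝓡 n) (𝓡 n) ∞ h.domChart.symm
        ((h.equiv.symm (h.codChart (f x))).1) := by
      rw [hd]
      exact contMDiffAt_symm_of_mem_maximalAtlas h.domChart_mem_maximalAtlas
        (h.domChart.map_source hxs)
    exact h3.comp (f x) (g := h.domChart.symm) (f := fun q => (h.equiv.symm (h.codChart q)).1)
      (h2.comp _ h1)
  have hcomp : mfderiv (𝓡 n) (𝓡 n) (L ∘ f) x = ContinuousLinearMap.id ℝ _ := by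
    rw [← mfderiv_id (I := 𝓡 n) (x := x)]
    refine Filter.EventuallyEq.mfderiv_eq ?_
    filter_upwards [h.domChart.open_source.mem_nhds hxs] with y hy using hL y hy
  have hfm : MDifferentiableAt (𝓡 n) (𝓡 b) f x := hf.contMDiff.mdifferentiableAt (by simp)
  rw [mfderiv_comp x (hLm.mdifferentiableAt (by simp)) hfm] at hcomp
  rw [LinearMap.ker_eq_bot']
  intro v hv
  have hv : mfderiv (𝓡 n) (𝓡 b) f x v = 0 := hv
  have h4 : mfderiv (𝓡 b) (𝓡 n) L (f x) (mfderiv (𝓡 n) (𝓡 b) f x v) = v :=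
    DFunLike.congr_fun hcomp v
  rw [hv, map_zero] at h4
  exact h4.symm

/-- A submersion has smooth local sections. -/
theorem Manifold.IsSubmersion.exists_section {f : X → B}
    (hf : IsSubmersion (𝓡 n) (𝓡 b) ∞ f) (x : X) :
    ∃ σ : B → X, ContMDiffAt (𝓡 b) (𝓡 n) ∞ σ (f x) ∧ σ (f x) = x ∧
      ∀ᶠ q in 𝓝 (f x), f (σ q) = q := by
  have h := hf.isSubmersionAt x
  have hxs := h.mem_domChart_source
  have hfx := h.mem_codChart_source
  let τ : B → EuclideanSpace ℝ (Fin n) :=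
    fun q => h.equiv.symm (h.codChart q, (h.equiv (h.domChart x)).2)
  have hwr (u) (hu : u ∈ h.domChart.target) :
      h.codChart (f (h.domChart.symm u)) = (h.equiv u).1 := by
    simpa using h.writtenInCharts (show u ∈ (h.domChart.extend (𝓡 n)).target by simpa using hu)
  have hτx : τ (f x) = h.domChart x := by
    have := hwr (h.domChart x) (h.domChart.map_source hxs)
    rw [h.domChart.left_inv hxs] at this
    simp [τ, this]
  have hτm : ContMDiffAt (𝓡 b) (𝓡 n) ∞ τ (f x) := by
    have h1 : ContMDiffAt (𝓡 b) (𝓡 b) ∞ h.codChart (f x) :=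
      contMDiffAt_of_mem_maximalAtlas h.codChart_mem_maximalAtlas hfx
    have h2 : ContMDiffAt (𝓡 b) (𝓡 n) ∞
        (fun z => h.equiv.symm (z, (h.equiv (h.domChart x)).2)) (h.codChart (f x)) :=
      ContDiffAt.contMDiffAt (by fun_prop)
    exact h2.comp _ h1
  have h3 : ContMDiffAt (𝓡 n) (𝓡 n) ∞ h.domChart.symm (τ (f x)) := by
    rw [hτx]
    exact contMDiffAt_symm_of_mem_maximalAtlas h.domChart_mem_maximalAtlas
      (h.domChart.map_source hxs)
  refine ⟨h.domChart.symm ∘ τ, h3.comp _ hτm, ?_, ?_⟩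
  · rw [Function.comp_apply, hτx, h.domChart.left_inv hxs]
  · have h4 : ∀ᶠ q in 𝓝 (f x), τ q ∈ h.domChart.target :=
      hτm.continuousAt.preimage_mem_nhds (h.domChart.open_target.mem_nhds
        (hτx ▸ h.domChart.map_source hxs))
    filter_upwards [h4, h.codChart.open_source.mem_nhds hfx] with q hq hq'
    have h5 := hwr _ hq
    refine h.codChart.injOn (h.source_subset_preimage_source (h.domChart.map_target hq)) hq' ?_
    exact h5.trans (by simp [τ])

theorem Manifold.IsSubmersion.surjective_mfderiv {f : X → B}
    (hf : IsSubmersion (𝓡 n) (𝓡 b) ∞ f) (x : X) :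
    Function.Surjective (mfderiv (𝓡 n) (𝓡 b) f x) := by
  obtain ⟨σ, hσ, hσx, hfσ⟩ := hf.exists_section x
  have hfm : MDifferentiableAt (𝓡 n) (𝓡 b) f (σ (f x)) := hf.contMDiff.mdifferentiableAt (by simp)
  have hcomp : mfderiv (𝓡 b) (𝓡 b) (f ∘ σ) (f x) = ContinuousLinearMap.id ℝ _ := by
    rw [← mfderiv_id (I := 𝓡 b) (x := f x)]
    exact Filter.EventuallyEq.mfderiv_eq hfσ
  rw [mfderiv_comp _ hfm (hσ.mdifferentiableAt (by simp))] at hcomp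
  intro w
  have h4 : mfderiv (𝓡 n) (𝓡 b) f (σ (f x)) (mfderiv (𝓡 b) (𝓡 n) σ (f x) w) = w :=
    DFunLike.congr_fun hcomp w
  rw [hσx] at h4
  exact ⟨_, h4⟩

theorem finrank_add_finrank_ker_mfderiv {f : X → B} {x : X}
    (hs : Function.Surjective (mfderiv (𝓡 n) (𝓡 b) f x)) :
    b + finrank ℝ (LinearMap.ker (mfderiv (𝓡 n) (𝓡 b) f x).toLinearMap) = n := by
  let D : EuclideanSpace ℝ (Fin n) →L[ℝ] EuclideanSpace ℝ (Fin b) := mfderiv (𝓡 n) (𝓡 b) f x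
  have h1 := LinearMap.finrank_range_add_finrank_ker D.toLinearMap
  have h2 : LinearMap.range D.toLinearMap = ⊤ := LinearMap.range_eq_top.mpr hs
  rw [h2, finrank_top, finrank_euclideanSpace_fin, finrank_euclideanSpace_fin] at h1
  exact h1

/-- Smoothness descends along surjective submersions. -/
theorem Manifold.IsSubmersion.contMDiff_of_comp {d : ℕ} {C : Type*} [TopologicalSpace C]
    [ChartedSpace (EuclideanSpace ℝ (Fin d)) C] {f : X → B}
    (hf : IsSubmersion (𝓡 n) (𝓡 b) ∞ f) (hs : Function.Surjective f) {p : B → C}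
    (hp : ContMDiff (𝓡 n) (𝓡 d) ∞ (p ∘ f)) : ContMDiff (𝓡 b) (𝓡 d) ∞ p := by
  intro q
  obtain ⟨x, rfl⟩ := hs q
  obtain ⟨σ, hσ, hσx, hfσ⟩ := hf.exists_section x
  refine ((hp (σ (f x))).comp (f x) hσ).congr_of_eventuallyEq ?_
  filter_upwards [hfσ] with q hq
  simp [hq]

/-- A map with vanishing differential on a preconnected manifold is constant. The codomain is not
required to be Hausdorff. -/
theorem eq_of_mfderiv_eq_zero [IsManifold (𝓡 n) ∞ X] [IsManifold (𝓡 b) ∞ B] [PreconnectedSpace X]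
    {f : X → B} (hf : MDifferentiable (𝓡 n) (𝓡 b) f)
    (h0 : ∀ x, mfderiv (𝓡 n) (𝓡 b) f x = 0) (x y : X) : f x = f y := by
  refine IsLocallyConstant.apply_eq_of_preconnectedSpace
    ((IsLocallyConstant.iff_eventually_eq f).mpr fun x => ?_) x y
  let φ := chartAt (EuclideanSpace ℝ (Fin n)) x
  let ψ := chartAt (EuclideanSpace ℝ (Fin b)) (f x)
  have hφ : φ.MDifferentiable (𝓡 n) (𝓡 n) := mdifferentiable_chart x
  have hψ : ψ.MDifferentiable (𝓡 b) (𝓡 b) := mdifferentiable_chart (f x)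
  let O : Set (EuclideanSpace ℝ (Fin n)) := φ.target ∩ φ.symm ⁻¹' (f ⁻¹' ψ.source)
  have hO : IsOpen O := φ.isOpen_inter_preimage_symm (ψ.open_source.preimage hf.continuous)
  have hx : x ∈ φ.source := mem_chart_source _ x
  have hxO : φ x ∈ O := by
    refine ⟨mem_chart_target _ x, ?_⟩
    change f (φ.symm (φ x)) ∈ ψ.source
    rw [φ.left_inv hx]
    exact mem_chart_source _ _
  obtain ⟨ε, hε, hball⟩ := Metric.isOpen_iff.mp hO _ hxO
  have hG (u) (hu : u ∈ O) : HasFDerivAt (ψ ∘ f ∘ φ.symm)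
      (0 : EuclideanSpace ℝ (Fin n) →L[ℝ] EuclideanSpace ℝ (Fin b)) u := by
    have h1 := (hψ.mdifferentiableAt hu.2).hasMFDerivAt.comp u
      ((hf (φ.symm u)).hasMFDerivAt.comp u (hφ.mdifferentiableAt_symm hu.1).hasMFDerivAt)
    rw [h0, ContinuousLinearMap.zero_comp, ContinuousLinearMap.comp_zero] at h1
    exact h1.hasFDerivAt
  filter_upwards [φ.open_source.mem_nhds hx, (φ.continuousAt hx).preimage_mem_nhds
    (Metric.ball_mem_nhds _ hε)] with y hy hyb
  have h2 := Metric.isOpen_ball.is_const_of_fderiv_eq_zero (𝕜 := ℝ)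
    (convex_ball (φ x) ε).isPreconnected
    (fun u hu => (hG u (hball hu)).differentiableAt.differentiableWithinAt)
    (fun u hu => (hG u (hball hu)).fderiv) hyb (Metric.mem_ball_self hε)
  simp only [Function.comp_apply, φ.left_inv hx, φ.left_inv hy] at h2
  refine ψ.injOn ?_ (mem_chart_source _ _) h2
  have : f (φ.symm (φ y)) ∈ ψ.source := (hball hyb).2
  rwa [φ.left_inv hy] at this

end

/-! ### Flat charts in the maximal atlas, and the submersion theorem -/

namespace FlatChart

variable {n b s r : ℕ} {X B : Type*} [TopologicalSpace X]
  [ChartedSpace (EuclideanSpace ℝ (Fin n)) X]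
  [TopologicalSpace B] [ChartedSpace (EuclideanSpace ℝ (Fin b)) B] {g : X → B} {x : X}
  (c : FlatChart n b g s r x)

/-- The coordinates of a flat chart, read in the model space of the manifold. -/
def chart (A : EuclideanSpace ℝ (Fin n) ≃L[ℝ] EuclideanSpace ℝ (Fin s) × EuclideanSpace ℝ (Fin r)) :
    OpenPartialHomeomorph X (EuclideanSpace ℝ (Fin n)) :=
  c.e.transHomeomorph A.symm.toHomeomorph

theorem chart_mem_maximalAtlas [IsManifold (𝓡 n) ∞ X]
    (A : EuclideanSpace ℝ (Fin n) ≃L[ℝ] EuclideanSpace ℝ (Fin s) × EuclideanSpace ℝ (Fin r)) :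
    c.chart A ∈ IsManifold.maximalAtlas (𝓡 n) ∞ X := by
  refine OpenPartialHomeomorph.mem_maximalAtlas_of_contMDiffOn _ ?_ ?_
  · exact A.symm.contDiff.contMDiff.comp_contMDiffOn c.contMDiffOn
  · exact c.contMDiffOn_symm.comp A.contDiff.contMDiff.contMDiffOn fun u hu => hu

end FlatChart

/-- A smooth map with surjective differentials is a submersion. -/
theorem isSubmersion_of_surjective_mfderiv {n b : ℕ} {X B : Type*} [TopologicalSpace X]
    [ChartedSpace (EuclideanSpace ℝ (Fin n)) X] [TopologicalSpace B]
    [ChartedSpace (EuclideanSpace ℝ (Fin b)) B] [IsManifold (𝓡 n) ∞ X] [IsManifold (𝓡 b) ∞ B]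
    {p : X → B} (hp : ContMDiff (𝓡 n) (𝓡 b) ∞ p)
    (hs : ∀ x, Function.Surjective (mfderiv (𝓡 n) (𝓡 b) p x)) :
    Manifold.IsSubmersion (𝓡 n) (𝓡 b) ∞ p := by
  refine ⟨EuclideanSpace ℝ (Fin (n - b)), inferInstance, inferInstance, fun x => ?_⟩
  have hfin (x : X) := finrank_add_finrank_ker_mfderiv (hs x)
  have hn : n = b + (n - b) := by have := hfin x; omega
  obtain ⟨c⟩ := nonempty_flatChart hp hn (fun x => by have := hfin x; omega) x
  let A : EuclideanSpace ℝ (Fin n) ≃L[ℝ]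
      EuclideanSpace ℝ (Fin b) × EuclideanSpace ℝ (Fin (n - b)) :=
    ContinuousLinearEquiv.ofFinrankEq (by simp [← hn])
  let π : EuclideanSpace ℝ (Fin b) ≃L[ℝ] EuclideanSpace ℝ (Fin b) :=
    (LinearEquiv.ofBijective c.π.toLinearMap
      ⟨LinearMap.injective_iff_surjective.mpr c.surjective_π,
        c.surjective_π⟩).toContinuousLinearEquiv
  let ψ := chartAt (EuclideanSpace ℝ (Fin b)) (p x)
  let T : EuclideanSpace ℝ (Fin b) ≃ₜ EuclideanSpace ℝ (Fin b) :=
    π.toHomeomorph.trans (Homeomorph.subRight (c.π (ψ (p x))))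
  have hT : ContDiff ℝ ∞ T := π.contDiff.sub contDiff_const
  have hT' : ContDiff ℝ ∞ T.symm := by
    have h1 : (T.symm : EuclideanSpace ℝ (Fin b) → _) = fun z => π.symm (z + c.π (ψ (p x))) := by
      funext z; rfl
    rw [h1]
    fun_prop
  refine Manifold.IsSubmersionAtOfComplement.mk_of_charts A (c.chart A) (ψ.transHomeomorph T)
    c.mem (mem_chart_source _ _) (c.chart_mem_maximalAtlas A) ?_ c.mapsTo ?_
  · refine OpenPartialHomeomorph.mem_maximalAtlas_of_contMDiffOn _ ?_ ?_
    · exact hT.contMDiff.comp_contMDiffOn (contMDiffOn_chart (I := 𝓡 b) (x := p x))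
    · exact (contMDiffOn_chart_symm (I := 𝓡 b) (x := p x)).comp hT'.contMDiff.contMDiffOn
        fun u hu => hu
  · intro u hu
    have hu : A u ∈ c.e.target := by simpa [FlatChart.chart] using hu
    have h1 := c.fst_apply _ (c.e.map_target hu)
    rw [c.e.right_inv hu] at h1
    have h2 : ψ.transHomeomorph T (p ((c.chart A).symm u)) = (A u).1 := h1.symm
    simpa using h2

/-! ### Unions of plaques as integral manifolds -/

namespace FlatChart

variable {n b s r : ℕ} {X B : Type*} [TopologicalSpace X]
  [ChartedSpace (EuclideanSpace ℝ (Fin n)) X]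
  [TopologicalSpace B] [ChartedSpace (EuclideanSpace ℝ (Fin b)) B] {g : X → B}

open Classical in
/-- The second component of a flat chart at `x`, as a chart of a subset `L` of `X` that coincides
with the plaque of `x` in the domain of the flat chart. Outside the target, the inverse takes values
in `L` that do not matter. -/
def plaqueChart {x : X} (c : FlatChart n b g s r x) {L : Set X} (hx : x ∈ L)
    (hL : ∀ y ∈ c.e.source, y ∈ L ↔ (c.e y).1 = 0) :
    OpenPartialHomeomorph L (EuclideanSpace ℝ (Fin r)) := by
  have htar (v) (hv : v ∈ Metric.ball (0 : EuclideanSpace ℝ (Fin r)) c.ε) :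
      ((0 : EuclideanSpace ℝ (Fin s)), v) ∈ c.e.target := by
    rw [c.target_eq]; exact ⟨Metric.mem_ball_self c.ε_pos, hv⟩
  have hmem (v) (hv : v ∈ Metric.ball (0 : EuclideanSpace ℝ (Fin r)) c.ε) :
      c.e.symm (0, v) ∈ L := by
    rw [hL _ (c.e.map_target (htar v hv)), c.e.right_inv (htar v hv)]
  let inv (v : EuclideanSpace ℝ (Fin r)) : L :=
    if h : c.e.symm (0, v) ∈ L then ⟨c.e.symm (0, v), h⟩ else ⟨x, hx⟩
  have hinv (v) (hv : v ∈ Metric.ball (0 : EuclideanSpace ℝ (Fin r)) c.ε) :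
      (inv v : X) = c.e.symm (0, v) := by
    simp only [inv, dif_pos (hmem v hv)]
  have hpair (y : L) (hy : (y : X) ∈ c.e.source) : c.e y = (0, (c.e y).2) :=
    Prod.ext ((hL y hy).mp y.2) rfl
  have hball (y : L) (hy : (y : X) ∈ c.e.source) : (c.e y).2 ∈ Metric.ball 0 c.ε := by
    have := c.e.map_source hy
    rw [c.target_eq] at this
    exact this.2
  exact
  { toFun := fun y => (c.e y).2
    invFun := inv
    source := {y | (y : X) ∈ c.e.source}
    target := Metric.ball 0 c.ε
    map_source' := hball
    map_target' := fun v hv => by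
      change (inv v : X) ∈ c.e.source
      rw [hinv v hv]
      exact c.e.map_target (htar v hv)
    left_inv' := fun y hy => by
      apply Subtype.ext
      rw [hinv _ (hball y hy), ← hpair y hy, c.e.left_inv hy]
    right_inv' := fun v hv => by
      rw [hinv v hv, c.e.right_inv (htar v hv)]
    open_source := c.e.open_source.preimage continuous_subtype_val
    open_target := Metric.isOpen_ball
    continuousOn_toFun := continuous_snd.comp_continuousOn
      (c.e.continuousOn.comp continuous_subtype_val.continuousOn fun y hy => hy)
    continuousOn_invFun := by
      rw [Topology.IsInducing.subtypeVal.continuousOn_iff]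
      refine ContinuousOn.congr (f := fun v => c.e.symm (0, v)) ?_ hinv
      exact c.e.continuousOn_symm.comp (by fun_prop) htar }

open Classical in
theorem coe_plaqueChart_symm {x : X} (c : FlatChart n b g s r x) {L : Set X} (hx : x ∈ L)
    (hL : ∀ y ∈ c.e.source, y ∈ L ↔ (c.e y).1 = 0) {v : EuclideanSpace ℝ (Fin r)}
    (hv : v ∈ Metric.ball 0 c.ε) : ((c.plaqueChart hx hL).symm v : X) = c.e.symm (0, v) := by
  have htar : ((0 : EuclideanSpace ℝ (Fin s)), v) ∈ c.e.target := by
    rw [c.target_eq]; exact ⟨Metric.mem_ball_self c.ε_pos, hv⟩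
  have hmem : c.e.symm (0, v) ∈ L := by
    rw [hL _ (c.e.map_target htar), c.e.right_inv htar]
  change ((if h : c.e.symm (0, v) ∈ L then ⟨c.e.symm (0, v), h⟩ else ⟨x, hx⟩ : L) : X) = _
  rw [dif_pos hmem]

/-- The charted space structure of a union `L` of plaques, with the subspace topology. -/
abbrev plaqueChartedSpace (c : ∀ x, FlatChart n b g s r x) {L : Set X}
    (hL : ∀ x ∈ L, ∀ y ∈ (c x).e.source, y ∈ L ↔ ((c x).e y).1 = 0) :
    ChartedSpace (EuclideanSpace ℝ (Fin r)) L where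
  atlas := range fun x : L => (c x).plaqueChart x.2 (hL x x.2)
  chartAt x := (c x).plaqueChart x.2 (hL x x.2)
  mem_chart_source x := (c x).mem
  chart_mem_atlas x := ⟨x, rfl⟩

theorem isManifold_plaqueChartedSpace [IsManifold (𝓡 n) ∞ X] (c : ∀ x, FlatChart n b g s r x)
    {L : Set X} (hL : ∀ x ∈ L, ∀ y ∈ (c x).e.source, y ∈ L ↔ ((c x).e y).1 = 0) :
    letI := plaqueChartedSpace c hL
    IsManifold (𝓡 r) ∞ L := by
  let := plaqueChartedSpace c hL
  refine isManifold_of_contDiffOn _ _ _ ?_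
  rintro _ _ ⟨x, rfl⟩ ⟨y, rfl⟩
  simp only [modelWithCornersSelf_coe, modelWithCornersSelf_coe_symm, Function.comp_id,
    Function.id_comp, preimage_id, range_id, inter_univ]
  have hm : ContMDiffOn (𝓡 r) (𝓡 r) ∞ (fun v => ((c y).e ((c x).e.symm (0, v))).2)
      ((((c x).plaqueChart x.2 (hL x x.2)).symm.trans
        ((c y).plaqueChart y.2 (hL y y.2))).source) := by
    have h0 (v) (hv : v ∈ (((c x).plaqueChart x.2 (hL x x.2)).symm.trans
        ((c y).plaqueChart y.2 (hL y y.2))).source) : v ∈ Metric.ball 0 (c x).ε ∧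
        (c x).e.symm (0, v) ∈ (c y).e.source := by
      rw [OpenPartialHomeomorph.trans_source] at hv
      refine ⟨hv.1, ?_⟩
      rw [← coe_plaqueChart_symm (c x) x.2 (hL x x.2) hv.1]
      exact hv.2
    refine contDiff_snd.contMDiff.comp_contMDiffOn ((c y).contMDiffOn.comp
      ((c x).contMDiffOn_symm.comp (ContDiff.contMDiff (by fun_prop)).contMDiffOn ?_) ?_)
    · intro v hv
      change (0, v) ∈ (c x).e.target
      rw [(c x).target_eq]
      exact ⟨Metric.mem_ball_self (c x).ε_pos, (h0 v hv).1⟩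
    · exact fun v hv => (h0 v hv).2
  refine (contMDiffOn_iff_contDiffOn.mp hm).congr fun v hv => ?_
  rw [OpenPartialHomeomorph.trans_source] at hv
  rw [← coe_plaqueChart_symm (c x) x.2 (hL x x.2) hv.1]
  rfl

theorem isImmersion_subtypeVal [IsManifold (𝓡 n) ∞ X] (hn : n = s + r)
    (c : ∀ x, FlatChart n b g s r x)
    {L : Set X} (hL : ∀ x ∈ L, ∀ y ∈ (c x).e.source, y ∈ L ↔ ((c x).e y).1 = 0) :
    letI := plaqueChartedSpace c hL
    Manifold.IsImmersion (𝓡 r) (𝓡 n) ∞ (Subtype.val : L → X) := by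
  let := plaqueChartedSpace c hL
  have := isManifold_plaqueChartedSpace c hL
  refine ⟨EuclideanSpace ℝ (Fin s), inferInstance, inferInstance, fun x => ?_⟩
  let A : EuclideanSpace ℝ (Fin n) ≃L[ℝ] EuclideanSpace ℝ (Fin s) × EuclideanSpace ℝ (Fin r) :=
    ContinuousLinearEquiv.ofFinrankEq (by simp [hn])
  refine Manifold.IsImmersionAtOfComplement.mk_of_charts
    ((ContinuousLinearEquiv.prodComm ℝ _ _).trans A.symm)
    ((c x).plaqueChart x.2 (hL x x.2)) ((c x).chart A) (c x).mem (c x).mem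
    (IsManifold.chart_mem_maximalAtlas x) ((c x).chart_mem_maximalAtlas A) (fun y hy => hy) ?_
  intro v hv
  have hv : v ∈ Metric.ball 0 (c x).ε := by
    rw [OpenPartialHomeomorph.extend_target] at hv
    exact hv.1
  have htar : ((0 : EuclideanSpace ℝ (Fin s)), v) ∈ (c x).e.target := by
    rw [(c x).target_eq]; exact ⟨Metric.mem_ball_self (c x).ε_pos, hv⟩
  have h1 : (c x).chart A (((c x).plaqueChart x.2 (hL x x.2)).symm v : X) = A.symm (0, v) := by
    rw [coe_plaqueChart_symm _ _ _ hv]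
    change A.symm ((c x).e ((c x).e.symm (0, v))) = _
    rw [(c x).e.right_inv htar]
  exact h1

/-- A union of plaques is an integral manifold of the kernel of `Tg`. -/
theorem isIntegralManifold_subtypeVal [IsManifold (𝓡 n) ∞ X] (hn : n = s + r)
    (hg : ContMDiff (𝓡 n) (𝓡 b) ∞ g)
    (hr : ∀ x, finrank ℝ (LinearMap.ker (mfderiv (𝓡 n) (𝓡 b) g x).toLinearMap) = r)
    {Δ : TangentDistribution n X}
    (hΔ : ∀ x, LinearMap.ker (mfderiv (𝓡 n) (𝓡 b) g x).toLinearMap = Δ x)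
    (c : ∀ x, FlatChart n b g s r x)
    {L : Set X} (hL : ∀ x ∈ L, ∀ y ∈ (c x).e.source, y ∈ L ↔ ((c x).e y).1 = 0) :
    letI := plaqueChartedSpace c hL
    IsIntegralManifold (r := r) Δ (Subtype.val : L → X) := by
  let := plaqueChartedSpace c hL
  have := isManifold_plaqueChartedSpace c hL
  have himm := isImmersion_subtypeVal hn c hL
  refine ⟨inferInstance, himm, Subtype.val_injective, fun x => ?_⟩
  have hval : MDifferentiableAt (𝓡 r) (𝓡 n) (Subtype.val : L → X) x :=
    himm.contMDiff.mdifferentiableAt (by simp)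
  have hgm : MDifferentiableAt (𝓡 n) (𝓡 b) g (x : X) := hg.mdifferentiableAt (by simp)
  have h0 : mfderiv (𝓡 r) (𝓡 b) (g ∘ (Subtype.val : L → X)) x = 0 := by
    have h1 : g ∘ (Subtype.val : L → X) =ᶠ[𝓝 x] fun _ => g x := by
      have : ∀ᶠ y : L in 𝓝 x, (y : X) ∈ (c x).e.source :=
        continuous_subtype_val.continuousAt.preimage_mem_nhds
          ((c x).e.open_source.mem_nhds (c x).mem)
      filter_upwards [this] with y hy
      refine (c x).eq_of_fst_eq _ hy _ (c x).mem ?_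
      rw [(hL x x.2 y hy).mp y.2, (c x).apply_self]
      rfl
    rw [h1.mfderiv_eq]
    exact mfderiv_const
  rw [mfderiv_comp x hgm hval] at h0
  rw [← hΔ]
  let D : EuclideanSpace ℝ (Fin r) →L[ℝ] EuclideanSpace ℝ (Fin n) :=
    mfderiv (𝓡 r) (𝓡 n) (Subtype.val : L → X) x
  let D' : EuclideanSpace ℝ (Fin n) →L[ℝ] EuclideanSpace ℝ (Fin b) := mfderiv (𝓡 n) (𝓡 b) g (x : X)
  have hker : LinearMap.ker D.toLinearMap = ⊥ := himm.ker_mfderiv_eq_bot x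
  have hfin : finrank ℝ (LinearMap.ker D'.toLinearMap) = r := hr x
  change LinearMap.range D.toLinearMap = LinearMap.ker D'.toLinearMap
  refine Submodule.eq_of_le_of_finrank_eq ?_ ?_
  · rintro _ ⟨v, rfl⟩
    exact DFunLike.congr_fun h0 v
  · rw [LinearMap.finrank_range_of_inj (LinearMap.ker_eq_bot.mp hker), hfin,
      finrank_euclideanSpace_fin]

end FlatChart

/-! ### The foliation by connected components of fibres -/

/-- The connected component through `x` of the fibre of `g` through `x`. -/
def fiberComponent {X B : Type*} [TopologicalSpace X] (g : X → B) (x : X) : Set X :=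
  connectedComponentIn (g ⁻¹' {g x}) x

/-- Two points are related if they lie in the same connected component of a fibre of `g`. -/
def fiberComponentSetoid {X B : Type*} [TopologicalSpace X] (g : X → B) : Setoid X :=
  Setoid.ker (fiberComponent g)

section Components

variable {X B : Type*} [TopologicalSpace X] {g : X → B}

theorem mem_fiberComponent_self (x : X) : x ∈ fiberComponent g x :=
  mem_connectedComponentIn rfl

theorem eq_of_mem_fiberComponent {x y : X} (h : y ∈ fiberComponent g x) : g y = g x :=
  connectedComponentIn_subset (g ⁻¹' {g x}) x h

theorem fiberComponentSetoid_iff {x y : X} :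
    fiberComponentSetoid g y x ↔ y ∈ fiberComponent g x := by
  constructor
  · intro h
    have h : fiberComponent g y = fiberComponent g x := h
    exact h ▸ mem_fiberComponent_self y
  · intro h
    change fiberComponent g y = fiberComponent g x
    have h1 : g y = g x := eq_of_mem_fiberComponent h
    rw [fiberComponent, h1]
    exact (connectedComponentIn_eq h).symm

theorem subset_fiberComponent {x : X} {L : Set X} (hL : IsPreconnected L)
    (hconst : ∀ y ∈ L, g y = g x) (hx : x ∈ L) : L ⊆ fiberComponent g x :=
  hL.subset_connectedComponentIn hx hconst

/-- The map induced by `g` on the space of components of its fibres. -/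
def fiberComponentLift (g : X → B) : Quotient (fiberComponentSetoid g) → B :=
  Quotient.lift g fun _ _ h => eq_of_mem_fiberComponent (fiberComponentSetoid_iff.mp h)

end Components

namespace FlatChart

variable {n b s r : ℕ} {X B : Type*} [TopologicalSpace X]
  [ChartedSpace (EuclideanSpace ℝ (Fin n)) X]
  [TopologicalSpace B] [ChartedSpace (EuclideanSpace ℝ (Fin b)) B] {g : X → B}

theorem fst_eq_iff {x : X} (c : FlatChart n b g s r x) {y y' : X} (hy : y ∈ c.e.source)
    (hy' : y' ∈ c.e.source) : (c.e y).1 = (c.e y').1 ↔ g y = g y' := by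
  refine ⟨c.eq_of_fst_eq y hy y' hy', fun h => ?_⟩
  rw [c.fst_apply y hy, c.fst_apply y' hy', h]

/-- Plaques are connected, hence contained in a single component of a fibre. -/
theorem mem_fiberComponent {x : X} (c : FlatChart n b g s r x) {y y' : X} (hy : y ∈ c.e.source)
    (hy' : y' ∈ c.e.source) (h : g y = g y') : y ∈ fiberComponent g y' := by
  have h1 := (c.fst_eq_iff hy hy').mpr h
  have hu := c.e.map_source hy
  have hu' := c.e.map_source hy'
  rw [c.target_eq] at hu hu'
  have htar (v) (hv : v ∈ Metric.ball (0 : EuclideanSpace ℝ (Fin r)) c.ε) :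
      ((c.e y').1, v) ∈ c.e.target := by
    rw [c.target_eq]; exact ⟨hu'.1, hv⟩
  let P : Set X := (fun v => c.e.symm ((c.e y').1, v)) '' Metric.ball 0 c.ε
  have hP : IsPreconnected P :=
    (convex_ball _ _).isPreconnected.image _
      (c.e.continuousOn_symm.comp (by fun_prop) htar)
  refine subset_fiberComponent hP ?_ ?_ (x := y') ?_
  · rintro _ ⟨v, hv, rfl⟩
    rw [← c.fst_eq_iff (c.e.map_target (htar v hv)) hy', c.e.right_inv (htar v hv)]
  · exact ⟨(c.e y').2, hu'.2, c.e.left_inv hy'⟩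
  · refine ⟨(c.e y).2, hu.2, ?_⟩
    change c.e.symm ((c.e y').1, (c.e y).2) = y
    rw [← h1]
    exact c.e.left_inv hy

theorem mem_fiber_iff {q : B} {x : X} (hx : x ∈ g ⁻¹' {q}) (c : FlatChart n b g s r x) {y : X}
    (hy : y ∈ c.e.source) : y ∈ g ⁻¹' {q} ↔ (c.e y).1 = 0 := by
  have h1 := c.fst_eq_iff hy c.mem
  rw [c.apply_self] at h1
  have hx : g x = q := hx
  rw [← hx, mem_preimage, mem_singleton_iff]
  exact h1.symm

theorem mem_fiberComponent_iff {z x : X} (hx : x ∈ fiberComponent g z)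
    (c : FlatChart n b g s r x) {y : X} (hy : y ∈ c.e.source) :
    y ∈ fiberComponent g z ↔ (c.e y).1 = 0 := by
  have h1 := c.fst_eq_iff hy c.mem
  rw [c.apply_self] at h1
  have h2 : fiberComponent g x = fiberComponent g z := fiberComponentSetoid_iff.mpr hx
  constructor
  · intro h
    exact h1.mpr ((eq_of_mem_fiberComponent h).trans (eq_of_mem_fiberComponent hx).symm)
  · intro h
    rw [← h2]
    exact c.mem_fiberComponent hy c.mem (h1.mp h)

/-- The projection onto the space of components of fibres is open: being an interior point of a
saturated set propagates along plaques, hence along components. -/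
theorem isOpenMap_mk (c : ∀ x, FlatChart n b g s r x) :
    IsOpenMap (Quotient.mk (fiberComponentSetoid g)) := by
  intro U hU
  rw [← isQuotientMap_quotient_mk'.isOpen_preimage, isOpen_iff_mem_nhds]
  set S : Set X := Quotient.mk (fiberComponentSetoid g) ⁻¹'
    (Quotient.mk (fiberComponentSetoid g) '' U) with hS
  have hsat (y z : X) (h : y ∈ fiberComponent g z) (hz : z ∈ S) : y ∈ S := by
    rw [hS, mem_preimage] at hz ⊢
    rwa [Quotient.sound (fiberComponentSetoid_iff.mpr h)]
  have key (x y y' : X) (hy : y ∈ (c x).e.source) (hy' : y' ∈ (c x).e.source) (h : g y = g y')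
      (hSy : S ∈ 𝓝 y) : S ∈ 𝓝 y' := by
    have hfst := ((c x).fst_eq_iff hy hy').mpr h
    -- the translation along the plaques that sends `y'` to `y`
    let τ : X → X := fun z => (c x).e.symm (((c x).e z).1, ((c x).e y).2)
    have hpair : (((c x).e y').1, ((c x).e y).2) = (c x).e y := by rw [← hfst]
    have hτy : τ y' = y := by
      change (c x).e.symm (((c x).e y').1, ((c x).e y).2) = y
      rw [hpair, (c x).e.left_inv hy]
    have hc1 : ContinuousAt (fun z => (((c x).e z).1, ((c x).e y).2)) y' :=
      (continuous_fst.continuousAt.comp ((c x).e.continuousAt hy')).prodMk continuousAt_const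
    have hτ : ContinuousAt τ y' := by
      refine ContinuousAt.comp (f := fun z => (((c x).e z).1, ((c x).e y).2))
        (g := (c x).e.symm) ?_ hc1
      rw [hpair]
      exact (c x).e.continuousAt_symm ((c x).e.map_source hy)
    have h1 : τ ⁻¹' S ∈ 𝓝 y' := hτ.preimage_mem_nhds (hτy.symm ▸ hSy)
    filter_upwards [h1, (c x).e.open_source.mem_nhds hy'] with z hz hzs
    have htar : (((c x).e z).1, ((c x).e y).2) ∈ (c x).e.target := by
      have h2 := (c x).e.map_source hzs
      have h3 := (c x).e.map_source hy
      rw [(c x).target_eq] at h2 h3 ⊢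
      exact ⟨h2.1, h3.2⟩
    have hτs : τ z ∈ (c x).e.source := (c x).e.map_target htar
    refine hsat z (τ z) ((c x).mem_fiberComponent hzs hτs ?_) hz
    rw [← (c x).fst_eq_iff hzs hτs]
    exact (congrArg Prod.fst ((c x).e.right_inv htar)).symm
  intro x hx
  obtain ⟨u, hu, hux⟩ := hx
  have hxu : x ∈ fiberComponent g u := fiberComponentSetoid_iff.mp (Quotient.exact hux.symm)
  have hSu : S ∈ 𝓝 u := Filter.mem_of_superset (hU.mem_nhds hu) fun z hz => ⟨z, hz, rfl⟩
  refine (isPreconnected_connectedComponentIn (F := g ⁻¹' {g u}) (x := u)).induction₂'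
    (fun y y' => S ∈ 𝓝 y → S ∈ 𝓝 y') ?_ (fun _ _ _ _ _ _ h1 h2 h => h2 (h1 h))
    (mem_fiberComponent_self u) hxu hSu
  intro y hy
  filter_upwards [mem_nhdsWithin_of_mem_nhds ((c y).e.open_source.mem_nhds (c y).mem),
    self_mem_nhdsWithin] with z hz hzu
  have h : g y = g z := (eq_of_mem_fiberComponent hy).trans (eq_of_mem_fiberComponent hzu).symm
  exact ⟨key y y z (c y).mem hz h, key y z y hz (c y).mem h.symm⟩

/-- The first component of a flat chart, as a chart of the space of components of fibres: distinct
plaques in the domain of a flat chart lie in distinct fibres, and `g` determines the plaque. -/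
def leafChart (c : ∀ x, FlatChart n b g s r x) (hg : Continuous g) (x : X) :
    OpenPartialHomeomorph (Quotient (fiberComponentSetoid g)) (EuclideanSpace ℝ (Fin s)) := by
  have htar (u) (hu : u ∈ Metric.ball (0 : EuclideanSpace ℝ (Fin s)) (c x).ε) :
      (u, (0 : EuclideanSpace ℝ (Fin r))) ∈ (c x).e.target := by
    rw [(c x).target_eq]; exact ⟨hu, Metric.mem_ball_self (c x).ε_pos⟩
  have hball (y) (hy : y ∈ (c x).e.source) : ((c x).e y).1 ∈ Metric.ball 0 (c x).ε := by
    have := (c x).e.map_source hy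
    rw [(c x).target_eq] at this
    exact this.1
  exact
  { toFun := fun q => (c x).π (chartAt (EuclideanSpace ℝ (Fin b)) (g x) (fiberComponentLift g q)) -
      (c x).π (chartAt (EuclideanSpace ℝ (Fin b)) (g x) (g x))
    invFun := fun u => Quotient.mk _ ((c x).e.symm (u, 0))
    source := Quotient.mk (fiberComponentSetoid g) '' (c x).e.source
    target := Metric.ball 0 (c x).ε
    map_source' := by
      rintro _ ⟨y, hy, rfl⟩
      have := (c x).fst_apply y hy
      exact this ▸ hball y hy
    map_target' := fun u hu => ⟨_, (c x).e.map_target (htar u hu), rfl⟩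
    left_inv' := by
      rintro _ ⟨y, hy, rfl⟩
      have h1 := (c x).fst_apply y hy
      change Quotient.mk _ ((c x).e.symm ((c x).π (chartAt (EuclideanSpace ℝ (Fin b)) (g x) (g y)) -
        (c x).π (chartAt (EuclideanSpace ℝ (Fin b)) (g x) (g x)), 0)) = _
      rw [← h1]
      have h2 := htar _ (hball y hy)
      refine Quotient.sound (fiberComponentSetoid_iff.mpr
        ((c x).mem_fiberComponent ((c x).e.map_target h2) hy ?_))
      rw [← (c x).fst_eq_iff ((c x).e.map_target h2) hy, (c x).e.right_inv h2]
    right_inv' := fun u hu => by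
      have h1 := (c x).fst_apply _ ((c x).e.map_target (htar u hu))
      rw [(c x).e.right_inv (htar u hu)] at h1
      exact h1.symm
    open_source := isOpenMap_mk c _ (c x).e.open_source
    open_target := Metric.isOpen_ball
    continuousOn_toFun := by
      have h1 : Continuous (fiberComponentLift g) := hg.quotient_lift _
      refine ((c x).π.continuous.comp_continuousOn
        ((chartAt (EuclideanSpace ℝ (Fin b)) (g x)).continuousOn.comp h1.continuousOn ?_)).sub
          continuousOn_const
      rintro _ ⟨y, hy, rfl⟩
      exact (c x).mapsTo hy
    continuousOn_invFun := continuous_quotient_mk'.comp_continuousOn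
      ((c x).e.continuousOn_symm.comp (by fun_prop) htar) }

/-- The charted space structure on the space of components of fibres. -/
abbrev leafChartedSpace (c : ∀ x, FlatChart n b g s r x) (hg : Continuous g) :
    ChartedSpace (EuclideanSpace ℝ (Fin s)) (Quotient (fiberComponentSetoid g)) where
  atlas := range (leafChart c hg)
  chartAt q := leafChart c hg q.out
  mem_chart_source q := ⟨q.out, (c q.out).mem, q.out_eq⟩
  chart_mem_atlas q := ⟨q.out, rfl⟩

theorem isManifold_leafChartedSpace [IsManifold (𝓡 b) ∞ B]
    (c : ∀ x, FlatChart n b g s r x) (hg : ContMDiff (𝓡 n) (𝓡 b) ∞ g) :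
    letI := leafChartedSpace c hg.continuous
    IsManifold (𝓡 s) ∞ (Quotient (fiberComponentSetoid g)) := by
  let := leafChartedSpace c hg.continuous
  refine isManifold_of_contDiffOn _ _ _ ?_
  rintro _ _ ⟨x, rfl⟩ ⟨y, rfl⟩
  simp only [modelWithCornersSelf_coe, modelWithCornersSelf_coe_symm, Function.comp_id,
    Function.id_comp, preimage_id, range_id, inter_univ]
  refine contMDiffOn_iff_contDiffOn.mp ?_
  have hsmooth : ContMDiffOn (𝓡 s) (𝓡 b) ∞ (fun u => chartAt (EuclideanSpace ℝ (Fin b)) (g y)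
      (g ((c x).e.symm (u, 0))))
      ((leafChart c hg.continuous x).symm.trans (leafChart c hg.continuous y)).source := by
    refine (contMDiffOn_chart (I := 𝓡 b) (x := g y)).comp (hg.comp_contMDiffOn
      ((c x).contMDiffOn_symm.comp (ContDiff.contMDiff (by fun_prop)).contMDiffOn ?_)) ?_
    · intro u hu
      rw [OpenPartialHomeomorph.trans_source] at hu
      change (u, 0) ∈ (c x).e.target
      rw [(c x).target_eq]
      exact ⟨hu.1, Metric.mem_ball_self (c x).ε_pos⟩
    · intro u hu
      rw [OpenPartialHomeomorph.trans_source] at hu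
      obtain ⟨z, hz, hzu⟩ := hu.2
      have h1 : g z = g ((c x).e.symm (u, 0)) := congrArg (fiberComponentLift g) hzu
      change g ((c x).e.symm (u, 0)) ∈ (chartAt (EuclideanSpace ℝ (Fin b)) (g y)).source
      rw [← h1]
      exact (c y).mapsTo hz
  have hπ : ContDiff ℝ ∞ fun w : EuclideanSpace ℝ (Fin b) =>
      (c y).π w - (c y).π (chartAt (EuclideanSpace ℝ (Fin b)) (g y) (g y)) := by fun_prop
  exact hπ.contMDiff.comp_contMDiffOn hsmooth

theorem isSubmersion_mk [IsManifold (𝓡 n) ∞ X] [IsManifold (𝓡 b) ∞ B] (hn : ∀ _ : X, n = s + r)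
    (c : ∀ x, FlatChart n b g s r x) (hg : ContMDiff (𝓡 n) (𝓡 b) ∞ g) :
    letI := leafChartedSpace c hg.continuous
    Manifold.IsSubmersion (𝓡 n) (𝓡 s) ∞ (Quotient.mk (fiberComponentSetoid g)) := by
  let := leafChartedSpace c hg.continuous
  have := isManifold_leafChartedSpace c hg
  refine ⟨EuclideanSpace ℝ (Fin r), inferInstance, inferInstance, fun x => ?_⟩
  let A : EuclideanSpace ℝ (Fin n) ≃L[ℝ] EuclideanSpace ℝ (Fin s) × EuclideanSpace ℝ (Fin r) :=
    ContinuousLinearEquiv.ofFinrankEq (by simp [← hn x])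
  refine Manifold.IsSubmersionAtOfComplement.mk_of_charts A ((c x).chart A)
    (leafChart c hg.continuous x) (c x).mem ⟨x, (c x).mem, rfl⟩ ((c x).chart_mem_maximalAtlas A)
    (IsManifold.subset_maximalAtlas ⟨x, rfl⟩) (fun y hy => ⟨y, hy, rfl⟩) ?_
  intro u hu
  have hu : A u ∈ (c x).e.target := by simpa [FlatChart.chart] using hu
  have h1 := (c x).fst_apply _ ((c x).e.map_target hu)
  rw [(c x).e.right_inv hu] at h1
  exact h1.symm

end FlatChart

section Foliation

universe u

variable {n b r : ℕ} {X : Type u} {B : Type*} [TopologicalSpace X]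
  [ChartedSpace (EuclideanSpace ℝ (Fin n)) X]
  [TopologicalSpace B] [ChartedSpace (EuclideanSpace ℝ (Fin b)) B] [IsManifold (𝓡 b) ∞ B]
  {g : X → B} {Δ : TangentDistribution n X}

/-- A map is constant on connected integral manifolds of a distribution that its differential
annihilates. -/
theorem IsConnectedIntegralSet.eq_of_mem {L : Set X} (hL : IsConnectedIntegralSet Δ L)
    (hg : ContMDiff (𝓡 n) (𝓡 b) ∞ g)
    (hΔ : ∀ x, Δ x ≤ LinearMap.ker (mfderiv (𝓡 n) (𝓡 b) g x).toLinearMap)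
    {x y : X} (hx : x ∈ L) (hy : y ∈ L) : g x = g y := by
  obtain ⟨d, S, _, _, j, hS, hj, rfl⟩ := hL
  obtain ⟨p, rfl⟩ := hx
  obtain ⟨q, rfl⟩ := hy
  have := hj.isManifold
  have hjm : ContMDiff (𝓡 d) (𝓡 n) ∞ j := hj.isImmersion.contMDiff
  refine eq_of_mfderiv_eq_zero ((hg.comp hjm).mdifferentiable (by simp)) (fun z => ?_) p q
  rw [mfderiv_comp z (hg.mdifferentiableAt (by simp)) (hjm.mdifferentiableAt (by simp))]
  ext1 v
  have h1 : mfderiv (𝓡 d) (𝓡 n) j z v ∈ Δ (j z) := by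
    rw [← hj.tangent z]
    exact ⟨v, rfl⟩
  exact hΔ _ h1

theorem IsConnectedIntegralSet.isPreconnected {L : Set X} (hL : IsConnectedIntegralSet Δ L) :
    IsPreconnected L := by
  obtain ⟨d, S, _, _, j, hS, hj, rfl⟩ := hL
  exact isPreconnected_range hj.isImmersion.contMDiff.continuous

variable [IsManifold (𝓡 n) ∞ X]

theorem isEmbeddedIntegralSet_fiber (hg : ContMDiff (𝓡 n) (𝓡 b) ∞ g)
    (hΔ : ∀ x, LinearMap.ker (mfderiv (𝓡 n) (𝓡 b) g x).toLinearMap = Δ x)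
    (hr : ∀ x, finrank ℝ (Δ x) = r) (hrn : r ≤ n) (q : B) :
    IsEmbeddedIntegralSet Δ (g ⁻¹' {q}) := by
  have hn : n = (n - r) + r := by omega
  have hr' (x) : finrank ℝ (LinearMap.ker (mfderiv (𝓡 n) (𝓡 b) g x).toLinearMap) = r := by
    rw [hΔ, hr]
  have c (x) : FlatChart n b g (n - r) r x := (nonempty_flatChart hg hn hr' x).some
  have hL : ∀ x ∈ g ⁻¹' {q}, ∀ y ∈ (c x).e.source, y ∈ g ⁻¹' {q} ↔ ((c x).e y).1 = 0 :=
    fun x hx y hy => (c x).mem_fiber_iff hx hy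
  exact ⟨r, g ⁻¹' {q}, inferInstance, FlatChart.plaqueChartedSpace c hL, Subtype.val,
    Topology.IsEmbedding.subtypeVal,
    FlatChart.isIntegralManifold_subtypeVal hn hg hr' hΔ c hL, Subtype.range_val⟩

theorem isLeaf_fiberComponent (hg : ContMDiff (𝓡 n) (𝓡 b) ∞ g)
    (hΔ : ∀ x, LinearMap.ker (mfderiv (𝓡 n) (𝓡 b) g x).toLinearMap = Δ x)
    (hr : ∀ x, finrank ℝ (Δ x) = r) (hrn : r ≤ n) (x : X) : IsLeaf Δ (fiberComponent g x) := by
  have hn : n = (n - r) + r := by omega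
  have hr' (x) : finrank ℝ (LinearMap.ker (mfderiv (𝓡 n) (𝓡 b) g x).toLinearMap) = r := by
    rw [hΔ, hr]
  have c (x) : FlatChart n b g (n - r) r x := (nonempty_flatChart hg hn hr' x).some
  have hL : ∀ y ∈ fiberComponent g x, ∀ z ∈ (c y).e.source,
      z ∈ fiberComponent g x ↔ ((c y).e z).1 = 0 :=
    fun y hy z hz => (c y).mem_fiberComponent_iff hy hz
  refine ⟨⟨r, fiberComponent g x, inferInstance, FlatChart.plaqueChartedSpace c hL, Subtype.val,
    isConnected_iff_connectedSpace.mp (isConnected_connectedComponentIn_iff.mpr rfl),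
    FlatChart.isIntegralManifold_subtypeVal hn hg hr' hΔ c hL, Subtype.range_val⟩, ?_⟩
  rintro L' hL' ⟨z, hzL, hzx⟩
  have h1 : fiberComponent g z = fiberComponent g x := fiberComponentSetoid_iff.mpr hzx
  rw [← h1]
  exact subset_fiberComponent hL'.isPreconnected
    (fun y hy => hL'.eq_of_mem hg (fun x => (hΔ x).ge) hy hzL) hzL

/-- The kernel of the differential of a map of constant rank determines a regular foliation, whose
leaves are the connected components of the fibres. -/
theorem exists_regularFoliation_fiberComponent (hg : ContMDiff (𝓡 n) (𝓡 b) ∞ g)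
    (hΔ : ∀ x, LinearMap.ker (mfderiv (𝓡 n) (𝓡 b) g x).toLinearMap = Δ x)
    (hr : ∀ x, finrank ℝ (Δ x) = r) (hrn : r ≤ n) :
    ∃ K : RegularFoliation Δ, K.rel = fiberComponentSetoid g := by
  have hn : n = (n - r) + r := by omega
  have hr' (x) : finrank ℝ (LinearMap.ker (mfderiv (𝓡 n) (𝓡 b) g x).toLinearMap) = r := by
    rw [hΔ, hr]
  have c (x) : FlatChart n b g (n - r) r x := (nonempty_flatChart hg hn hr' x).some
  let := FlatChart.leafChartedSpace c hg.continuous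
  have hmanifold := FlatChart.isManifold_leafChartedSpace c hg
  have hsub := FlatChart.isSubmersion_mk (fun _ => hn) c hg
  have hlift : ContMDiff (𝓡 (n - r)) (𝓡 b) ∞ (fiberComponentLift g) :=
    hsub.contMDiff_of_comp Quotient.mk_surjective hg
  refine ⟨⟨fiberComponentSetoid g, fun x => ?_, n - r, FlatChart.leafChartedSpace c hg.continuous,
    hmanifold, hsub, fun x => ?_⟩, rfl⟩
  · have h1 : {y | fiberComponentSetoid g y x} = fiberComponent g x :=
      Set.ext fun y => fiberComponentSetoid_iff
    rw [h1]
    exact isLeaf_fiberComponent hg hΔ hr hrn x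
  · rw [← hΔ]
    have h1 := finrank_add_finrank_ker_mfderiv (hsub.surjective_mfderiv x)
    have h2 := hr' x
    have hcomp : mfderiv (𝓡 n) (𝓡 b) g x =
        (mfderiv (𝓡 (n - r)) (𝓡 b) (fiberComponentLift g) (Quotient.mk _ x)).comp
          (mfderiv (𝓡 n) (𝓡 (n - r)) (Quotient.mk (fiberComponentSetoid g)) x) :=
      mfderiv_comp x (hlift.mdifferentiableAt (by simp)) (hsub.contMDiff.mdifferentiableAt (by simp))
    let D : EuclideanSpace ℝ (Fin n) →L[ℝ] EuclideanSpace ℝ (Fin (n - r)) :=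
      mfderiv (𝓡 n) (𝓡 (n - r)) (Quotient.mk (fiberComponentSetoid g)) x
    let D' : EuclideanSpace ℝ (Fin n) →L[ℝ] EuclideanSpace ℝ (Fin b) := mfderiv (𝓡 n) (𝓡 b) g x
    have h1' : n - r + finrank ℝ (LinearMap.ker D.toLinearMap) = n := h1
    have h2' : finrank ℝ (LinearMap.ker D'.toLinearMap) = r := h2
    change LinearMap.ker D.toLinearMap = LinearMap.ker D'.toLinearMap
    refine Submodule.eq_of_le_of_finrank_eq (fun v hv => ?_) (by omega)
    have hv : mfderiv (𝓡 n) (𝓡 (n - r)) (Quotient.mk (fiberComponentSetoid g)) x v = 0 := hv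
    exact (DFunLike.congr_fun hcomp v).trans
      ((congrArg (fun w => mfderiv (𝓡 (n - r)) (𝓡 b) (fiberComponentLift g) (Quotient.mk _ x) w)
        hv).trans (map_zero (mfderiv (𝓡 (n - r)) (𝓡 b) (fiberComponentLift g) (Quotient.mk _ x))))

end Foliation

/-! ### Symplectic linear algebra -/

/-- Let `F` be the isomorphism `T ≃ T^*` of a symplectic form, `α` a linearly independent family in
`T^*` and `J : V → T` an injective map with range `⋂ ker β_i`. The symplectic orthogonal of
`⋂ ker α_j` is spanned by the vectors `F⁻¹ α_j`, and a combination of these lies in the range of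
`J` if and only if the matrix of Poisson brackets annihilates its coefficients. -/
theorem finrank_eq_sub_rank {T V : Type*} [AddCommGroup T] [Module ℝ T] [AddCommGroup V]
    [Module ℝ V] {a₀ a : ℕ} (F : T ≃ₗ[ℝ] Dual ℝ T) (α : Fin a₀ → Dual ℝ T)
    (hα : LinearIndependent ℝ α) (β : Fin a → Dual ℝ T) (J : V →ₗ[ℝ] T)
    (hJ : LinearMap.ker J = ⊥) (hJr : LinearMap.range J = ⨅ i, LinearMap.ker (β i))
    (D : Submodule ℝ V)
    (hD : ∀ v, v ∈ D ↔ ∀ w ∈ ⨅ j, LinearMap.ker (α j), F (J v) w = 0) :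
    finrank ℝ D =
      a₀ - (Matrix.of fun i j => F (F.symm (β i)) (F.symm (α j))).rank := by
  set P : Matrix (Fin a) (Fin a₀) ℝ := Matrix.of fun i j => F (F.symm (β i)) (F.symm (α j)) with hP
  let S : (Fin a₀ → ℝ) →ₗ[ℝ] T := Fintype.linearCombination ℝ fun j => F.symm (α j)
  have hFS (c : Fin a₀ → ℝ) : F (S c) = ∑ j, c j • α j := by
    simp [S, Fintype.linearCombination_apply]
  have hS : LinearMap.ker S = ⊥ := by
    rw [LinearMap.ker_eq_bot']
    intro c hc
    have h1 := hFS c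
    rw [hc, map_zero] at h1
    exact funext (Fintype.linearIndependent_iff.mp hα c h1.symm)
  have hPS (c : Fin a₀ → ℝ) (i : Fin a) : P.mulVec c i = β i (S c) := by
    simp [hP, Matrix.mulVec, dotProduct, S, Fintype.linearCombination_apply, mul_comm]
  have key : D.map J = (LinearMap.ker P.mulVecLin).map S := by
    ext u
    constructor
    · rintro ⟨v, hv, rfl⟩
      have h1 : F (J v) ∈ Submodule.span ℝ (range α) := by
        refine mem_span_of_iInf_ker_le_ker fun w hw => ?_
        exact (hD v).mp hv w hw
      obtain ⟨c, hc⟩ := (Submodule.mem_span_range_iff_exists_fun ℝ).mp h1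
      have h2 : S c = J v := F.injective ((hFS c).trans hc)
      refine ⟨c, ?_, h2⟩
      change P.mulVecLin c = 0
      funext i
      rw [Matrix.mulVecLin_apply, hPS, h2]
      have h3 : J v ∈ ⨅ i, LinearMap.ker (β i) := hJr ▸ LinearMap.mem_range_self J v
      exact (Submodule.mem_iInf _).mp h3 i
    · rintro ⟨c, hc, rfl⟩
      have h1 : S c ∈ LinearMap.range J := by
        rw [hJr, Submodule.mem_iInf]
        intro i
        rw [LinearMap.mem_ker, ← hPS]
        exact congrFun hc i
      obtain ⟨v, hv⟩ := h1
      refine ⟨v, (hD v).mpr fun w hw => ?_, hv⟩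
      rw [hv, hFS]
      rw [Submodule.mem_iInf] at hw
      simp only [LinearMap.sum_apply, LinearMap.smul_apply]
      exact Finset.sum_eq_zero fun j _ => by rw [LinearMap.mem_ker.mp (hw j), smul_zero]
  have h1 : finrank ℝ D = finrank ℝ (LinearMap.ker P.mulVecLin) := by
    rw [(Submodule.equivMapOfInjective J (LinearMap.ker_eq_bot.mp hJ) D).finrank_eq, key]
    exact (Submodule.equivMapOfInjective S (LinearMap.ker_eq_bot.mp hS) _).finrank_eq.symm
  have h2 := LinearMap.finrank_range_add_finrank_ker P.mulVecLin
  rw [Module.finrank_fin_fun] at h2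
  have h3 : P.rank = finrank ℝ (LinearMap.range P.mulVecLin) := rfl
  omega

/-! ### Kernels of pulled back forms and maps between leaf spaces -/

section Forms

variable {n : ℕ} {X : Type*} [TopologicalSpace X] [ChartedSpace (EuclideanSpace ℝ (Fin n)) X]

theorem TwoForm.mem_ker_iff {α : TwoForm n X} {x : X} {v : TangentSpace (𝓡 n) x} :
    v ∈ α.ker x ↔ ∀ w, α x ![v, w] = 0 :=
  ⟨fun h w => LinearMap.congr_fun (LinearMap.mem_ker.mp h) w,
    fun h => LinearMap.mem_ker.mpr (LinearMap.ext h)⟩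

theorem TwoForm.pullback_apply {m : ℕ} {Y : Type*} [TopologicalSpace Y]
    [ChartedSpace (EuclideanSpace ℝ (Fin m)) Y] (f : Y → X) (α : TwoForm n X) (y : Y)
    (v w : TangentSpace (𝓡 m) y) :
    α.pullback f y ![v, w] =
      α (f y) ![mfderiv (𝓡 m) (𝓡 n) f y v, mfderiv (𝓡 m) (𝓡 n) f y w] := by
  change α (f y) (mfderiv (𝓡 m) (𝓡 n) f y ∘ ![v, w]) = _
  congr 1
  ext i
  fin_cases i <;> rfl

end Forms

section Foliations

universe u

variable {n : ℕ} {X : Type u} [TopologicalSpace X] [ChartedSpace (EuclideanSpace ℝ (Fin n)) X]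
  {Δ : TangentDistribution n X}

instance (K : RegularFoliation Δ) : IsManifold (𝓡 K.codim) ∞ K.LeafSpace := K.isManifold

theorem RegularFoliation.proj_eq_iff (K : RegularFoliation Δ) {x y : X} :
    K.proj x = K.proj y ↔ K.rel x y := Quotient.eq

theorem RegularFoliation.isSubmersion_proj (K : RegularFoliation Δ) :
    Manifold.IsSubmersion (𝓡 n) (𝓡 K.codim) ∞ K.proj := K.submersion

/-- If the leaves of `K` are contained in leaves of `K'`, then the induced map between the leaf
spaces is a submersion. -/
theorem RegularFoliation.exists_isSubmersion_leafSpace {Δ' : TangentDistribution n X}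
    (K : RegularFoliation Δ) (K' : RegularFoliation Δ') (h : ∀ x, K.leaf x ⊆ K'.leaf x) :
    ∃ p : K.LeafSpace → K'.LeafSpace,
      Manifold.IsSubmersion (𝓡 K.codim) (𝓡 K'.codim) ∞ p ∧ p ∘ K.proj = K'.proj := by
  let p : K.LeafSpace → K'.LeafSpace :=
    Quotient.lift K'.proj fun x y hxy => K'.proj_eq_iff.mpr (h y hxy)
  have hp : p ∘ K.proj = K'.proj := rfl
  have hpm : ContMDiff (𝓡 K.codim) (𝓡 K'.codim) ∞ p :=
    K.isSubmersion_proj.contMDiff_of_comp Quotient.mk_surjective K'.isSubmersion_proj.contMDiff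
  refine ⟨p, isSubmersion_of_surjective_mfderiv hpm ?_, hp⟩
  rintro ⟨x⟩ w
  obtain ⟨v, hv⟩ := K'.isSubmersion_proj.surjective_mfderiv x w
  have h1 : mfderiv (𝓡 n) (𝓡 K'.codim) (p ∘ K.proj) x = _ :=
    mfderiv_comp x (hpm.mdifferentiableAt (by simp))
      (K.isSubmersion_proj.contMDiff.mdifferentiableAt (by simp))
  exact ⟨mfderiv (𝓡 n) (𝓡 K.codim) K.proj x v, (DFunLike.congr_fun h1 v).symm.trans hv⟩

end Foliations

/-- A `2`-form on `N` is pulled back to `M` and further to `M_c`: the intersection of the first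
kernel with the tangent spaces of `M_c` is contained in the second kernel. -/
theorem TwoForm.inter_ker_pullback_le {n m k : ℕ} {N M Mc : Type*} [TopologicalSpace N]
    [ChartedSpace (EuclideanSpace ℝ (Fin n)) N] [TopologicalSpace M]
    [ChartedSpace (EuclideanSpace ℝ (Fin m)) M] [TopologicalSpace Mc]
    [ChartedSpace (EuclideanSpace ℝ (Fin k)) Mc] (α : TwoForm n N) {ι : M → N} {ιc : Mc → M}
    (hι : MDifferentiable (𝓡 m) (𝓡 n) ι) (hιc : MDifferentiable (𝓡 k) (𝓡 m) ιc) (x : Mc) :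
    TangentDistribution.inter (m := k) (α.pullback ι : TwoForm m M).ker ιc x ≤
      (α.pullback (ι ∘ ιc) : TwoForm k Mc).ker x := by
  intro v hv
  rw [TwoForm.mem_ker_iff]
  intro w
  have h1 := TwoForm.mem_ker_iff.mp (show mfderiv (𝓡 k) (𝓡 m) ιc x v ∈
    (α.pullback ι : TwoForm m M).ker (ιc x) from hv) (mfderiv (𝓡 k) (𝓡 m) ιc x w)
  rw [TwoForm.pullback_apply] at h1 ⊢
  rw [mfderiv_comp x (hι _) (hιc x)]
  exact h1

/-- The rank formula for the intersection of `ker ω` with the tangent spaces of `M_c`. -/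
theorem finrank_inter_ker_pullback {n m k a₀ a : ℕ}
    {N M Mc : Type*} [TopologicalSpace N] [ChartedSpace (EuclideanSpace ℝ (Fin n)) N]
    [TopologicalSpace M] [ChartedSpace (EuclideanSpace ℝ (Fin m)) M]
    [TopologicalSpace Mc] [ChartedSpace (EuclideanSpace ℝ (Fin k)) Mc]
    (Ω : SymplecticForm n N) (φ₀ : Fin a₀ → N → ℝ) (φ : Fin a → N → ℝ)
    (ι : M → N) (ιc : Mc → M)
    (hM : RegularlyDefinedBy (n := n) (m := m) ι φ₀)
    (hιc : MDifferentiable (𝓡 k) (𝓡 m) ιc)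
    (hMc : RegularlyDefinedBy (n := n) (m := k) (ι ∘ ιc) φ) (x : Mc) :
    finrank ℝ (TangentDistribution.inter (m := k) (Ω.form.pullback ι : TwoForm m M).ker ιc x) =
      Ω.dNumber φ₀ φ (ι (ιc x)) := by
  have hι : MDifferentiable (𝓡 m) (𝓡 n) ι := hM.embedding.contMDiff.mdifferentiable (by simp)
  have hcomp := mfderiv_comp x (hι (ιc x)) (hιc x)
  refine finrank_eq_sub_rank (Ω.flatEquiv (ι (ιc x)))
    (fun j => (mvfderiv (𝓡 n) (φ₀ j) (ι (ιc x))).toLinearMap) ?_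
    (fun i => (mvfderiv (𝓡 n) (φ i) (ι (ιc x))).toLinearMap)
    (mfderiv (𝓡 k) (𝓡 n) (ι ∘ ιc) x).toLinearMap
    (hMc.embedding.isImmersion.ker_mfderiv_eq_bot x) (hMc.tangent x) _ fun v => ?_
  · exact (hM.independent _ ⟨ιc x, rfl⟩).map' (ContinuousLinearMap.coeLM ℝ)
      (LinearMap.ker_eq_bot.mpr ContinuousLinearMap.coe_injective)
  · have h1 : v ∈ TangentDistribution.inter (m := k) (Ω.form.pullback ι : TwoForm m M).ker ιc x ↔
        ∀ w, Ω.form (ι (ιc x)) ![mfderiv (𝓡 m) (𝓡 n) ι (ιc x) (mfderiv (𝓡 k) (𝓡 m) ιc x v),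
          mfderiv (𝓡 m) (𝓡 n) ι (ιc x) w] = 0 := by
      refine TwoForm.mem_ker_iff.trans (forall_congr' fun w => ?_)
      rw [← TwoForm.pullback_apply]
      rfl
    rw [h1, ← hM.tangent (ιc x)]
    have h2 : mfderiv (𝓡 k) (𝓡 n) (ι ∘ ιc) x v =
      mfderiv (𝓡 m) (𝓡 n) ι (ιc x) (mfderiv (𝓡 k) (𝓡 m) ιc x v) := DFunLike.congr_fun hcomp v
    constructor
    · rintro h _ ⟨w, rfl⟩
      exact (congrArg (fun u => Ω.form (ι (ιc x)) ![u, mfderiv (𝓡 m) (𝓡 n) ι (ιc x) w]) h2).trans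
        (h w)
    · intro h w
      exact (congrArg (fun u => Ω.form (ι (ιc x)) ![u, mfderiv (𝓡 m) (𝓡 n) ι (ιc x) w])
        h2).symm.trans (h _ ⟨w, rfl⟩)

end

theorem theorem3p8 {n m k a₀ a : ℕ}
    {N : Type*} [TopologicalSpace N] [T2Space N] [SecondCountableTopology N]
    [ChartedSpace (EuclideanSpace ℝ (Fin n)) N] [IsManifold (𝓡 n) ∞ N]
    {M : Type*} [TopologicalSpace M]
    [ChartedSpace (EuclideanSpace ℝ (Fin m)) M] [IsManifold (𝓡 m) ∞ M]
    {Mc : Type*} [TopologicalSpace Mc]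
    [ChartedSpace (EuclideanSpace ℝ (Fin k)) Mc] [IsManifold (𝓡 k) ∞ Mc]
    (Ω : SymplecticForm n N) (φ₀ : Fin a₀ → N → ℝ) (φ : Fin a → N → ℝ)
    (ι : M → N) (ιc : Mc → M)
    (hM : RegularlyDefinedBy (n := n) (m := m) ι φ₀)
    (hιc : Manifold.IsSmoothEmbedding (𝓡 k) (𝓡 m) ∞ ιc)
    (hMc : RegularlyDefinedBy (n := n) (m := k) (ι ∘ ιc) φ)
    (ωM : TwoForm m M) (hωM : ωM = Ω.form.pullback ι)
    (ωc : TwoForm k Mc) (hωc : ωc = Ω.form.pullback (ι ∘ ιc))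
    (Kc : RegularFoliation ωc.ker)
    (K : RegularFoliation ωM.ker)
    (Δ : TangentDistribution k Mc) (hΔ : Δ = TangentDistribution.inter (m := k) ωM.ker ιc)
    (hrank : ∃ r : ℕ, ∀ x : Mc, Module.finrank ℝ (Δ x) = r) :
    (∀ x : Mc, Module.finrank ℝ (Δ x) = Ω.dNumber φ₀ φ (ι (ιc x))) ∧
    (∀ y : M, IsEmbeddedIntegralSet Δ (ιc ⁻¹' K.leaf y)) ∧
    ∃ Kt : RegularFoliation Δ,
      (∀ x : Mc, Kt.leaf x = connectedComponentIn (ιc ⁻¹' K.leaf (ιc x)) x) ∧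
      (∀ x : Mc, Kt.leaf x ⊆ Kc.leaf x) ∧
      (∃ p : Kt.LeafSpace → Kc.LeafSpace,
        Manifold.IsSubmersion (𝓡 Kt.codim) (𝓡 Kc.codim) ∞ p ∧ p ∘ Kt.proj = Kc.proj) ∧
      ((∀ y : M, IsPreconnected (ιc ⁻¹' K.leaf y)) →
        (∀ x : Mc, Kt.leaf x = ιc ⁻¹' K.leaf (ιc x)) ∧
        (T2Space K.LeafSpace → T2Space Kt.LeafSpace)) := by
  have hιm : MDifferentiable (𝓡 m) (𝓡 n) ι := hM.embedding.contMDiff.mdifferentiable (by simp)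
  have hιcm : MDifferentiable (𝓡 k) (𝓡 m) ιc := hιc.contMDiff.mdifferentiable (by simp)
  -- the fibres of `g` are the intersections of `M_c` with the leaves of `K`
  let g : Mc → K.LeafSpace := K.proj ∘ ιc
  have hg : ContMDiff (𝓡 k) (𝓡 K.codim) ∞ g := K.isSubmersion_proj.contMDiff.comp hιc.contMDiff
  have hgΔ (x : Mc) : LinearMap.ker (mfderiv (𝓡 k) (𝓡 K.codim) g x).toLinearMap = Δ x := by
    have h1 : mfderiv (𝓡 k) (𝓡 K.codim) g x = (mfderiv (𝓡 m) (𝓡 K.codim) K.proj (ιc x)).comp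
        (mfderiv (𝓡 k) (𝓡 m) ιc x) :=
      mfderiv_comp x (K.isSubmersion_proj.contMDiff.mdifferentiableAt (by simp)) (hιcm x)
    have h2 := K.ker_mfderiv (ιc x)
    rw [h1, hΔ]
    change Submodule.comap _ (LinearMap.ker _) = Submodule.comap _ _
    rw [← h2]
    rfl
  have hleaf (y : M) : ιc ⁻¹' K.leaf y = g ⁻¹' {K.proj y} :=
    Set.ext fun z => K.proj_eq_iff.symm
  -- if `M_c` is empty, then the rank may be taken to be `0`
  obtain ⟨r, hrk, hr⟩ : ∃ r ≤ k, ∀ x : Mc, finrank ℝ (Δ x) = r := by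
    obtain ⟨r, hr⟩ := hrank
    rcases isEmpty_or_nonempty Mc with hempty | ⟨⟨x⟩⟩
    · exact ⟨0, Nat.zero_le k, fun x => hempty.elim x⟩
    · refine ⟨r, ?_, hr⟩
      let D : Submodule ℝ (EuclideanSpace ℝ (Fin k)) := Δ x
      have h1 : finrank ℝ D ≤ k := by simpa using D.finrank_le
      exact (hr x).symm.trans_le h1
  obtain ⟨Kt, hKt⟩ := exists_regularFoliation_fiberComponent hg hgΔ hr hrk
  have hKtleaf (x : Mc) : Kt.leaf x = fiberComponent g x := by
    ext y
    change Kt.rel y x ↔ _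
    rw [hKt, fiberComponentSetoid_iff]
  have hsub (x : Mc) : Kt.leaf x ⊆ Kc.leaf x := by
    intro y hy
    refine Kc.proj_eq_iff.mp (IsConnectedIntegralSet.eq_of_mem (Kt.isLeaf x).1
      Kc.isSubmersion_proj.contMDiff (fun z => ?_) hy (Kt.rel.refl x))
    refine le_trans ?_ (Kc.ker_mfderiv z).ge
    rw [hΔ, hωM, hωc]
    exact Ω.form.inter_ker_pullback_le hιm hιcm z
  refine ⟨fun x => ?_, fun y => ?_, Kt, fun x => ?_, hsub,
    Kt.exists_isSubmersion_leafSpace Kc hsub, fun hconn => ?_⟩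
  · rw [hΔ, hωM]
    exact finrank_inter_ker_pullback Ω φ₀ φ ι ιc hM hιcm hMc x
  · rw [hleaf]
    exact isEmbeddedIntegralSet_fiber hg hgΔ hr hrk _
  · rw [hKtleaf, hleaf]
    rfl
  · have hfib (x : Mc) : Kt.leaf x = g ⁻¹' {g x} := by
      rw [hKtleaf]
      refine IsPreconnected.connectedComponentIn ?_ rfl
      exact hleaf (ιc x) ▸ hconn (ιc x)
    refine ⟨fun x => (hfib x).trans (hleaf _).symm, fun hT2 => ?_⟩
    let q : Kt.LeafSpace → K.LeafSpace := Quotient.lift g fun x y hxy => by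
      have h1 : x ∈ Kt.leaf y := hxy
      rw [hfib] at h1
      exact h1
    have hq : Continuous q := hg.continuous.quotient_lift _
    refine T2Space.of_injective_continuous (f := q) ?_ hq
    rintro ⟨x⟩ ⟨y⟩ hxy
    have h1 : x ∈ Kt.leaf y := by
      rw [hfib]
      exact hxy
    exact Quotient.sound h1
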